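/- Let $n\ge 0$, $p\in(1,+\infty)$, let $\mathbb D\subset\mathbb C$ be the open unit disc and $|\cdot|$ the Hermitian norm on $\mathbb C^n$. Let $\phi:\partial\mathbb D\times\mathbb C^n\to[0,+\infty)$ be Borel measurable, with $\phi(s,\cdot)$ convex for every $s\in\partial\mathbb D$, and satisfying the $p$-uniform growth conditions: there are $c,C,A>0$ with $c|w|^p-A\le\phi(s,w)\le C|w|^p+A$ for all $s\in\partial\mathbb D$, $w\in\mathbb C^n$. Assume that $\phi(s,\lambda z)=|\lambda|^p\phi(s,z)$ for all $s\in\partial\mathbb D$, $\lambda\in\mathbb C$, $z\in\mathbb C^n$. For $(t,z)\in\mathbb D\times\mathbb C^n$ let $[\phi](t,z)$ be the upper (Perron--Bremermann) envelope, i.e. the supremum of $\psi(t,z)$ over all plurisubharmonic $\psi:\mathbb D\times\mathbb C^n\to\mathbb R$ such that $\psi(\tau,w)\le\sup_{s\in\partial\mathbb D}\phi(s,w)$ on $\mathbb D\times\mathbb C^n$ and, for almost every $s\in\partial\mathbb D$ and every $w_0\in\mathbb C^n$, $$\limsup_{(0,1)\times\mathbb C^n\ni(r,w)\to(1,w_0)}\psi(rs,w)\le\phi(s,w_0).$$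 (A plurisubharmonic function is an upper semicontinuous function with values in $[-\infty,+\infty)$ satisfying the sub-mean value inequality on every closed disc of a complex line contained in its domain; the constant $-\infty$ is allowed.) Then $[\phi]$ is finite and nonnegative on $\mathbb D\times\mathbb C^n$, and: (i) $[\phi](t,\lambda z)=|\lambda|^p[\phi](t,z)$ for all $t\in\mathbb D$, $\lambda\in\mathbb C$, $z\in\mathbb C^n$. (ii) $\log[\phi]$ (with $\log 0=-\infty$) is plurisubharmonic on $\mathbb D\times\mathbb C^n$. (iii) If $h:\mathbb D\to\mathbb C^n$ is holomorphic and $t\mapsto[\phi](t,h(t))$ is harmonic on $\mathbb D$, then $t\mapsto[\phi](t,h(t))$ is constant on $\mathbb D$. -/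

import Mathlib

open Set Filter Topology MeasureTheory

namespace PshInterp

noncomputable section

/-- `ℂⁿ` with its Hermitian norm. -/
abbrev Cn (n : ℕ) : Type := EuclideanSpace ℂ (Fin n)

/-- The open unit disc `𝔻`. -/
abbrev disc : Set ℂ := Metric.ball (0 : ℂ) 1

/-- The unit circle `∂𝔻`. -/
abbrev bdry : Type := Metric.sphere (0 : ℂ) 1

/-- The point `exp (i θ)` of the unit circle. -/
def bdryPt (θ : ℝ) : bdry := ⟨circleMap 0 1 θ, circleMap_mem_sphere 0 zero_le_one θ⟩

/-- The mean over an angle in `(0, 2π]` of an extended real-valued function of the angle: the mean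
of the positive part minus the mean of the negative part. (It is applied to functions bounded
above, so the first mean is finite.) -/
def angularMean (v : ℝ → EReal) : EReal :=
  ((⨍⁻ θ in Ioc 0 (2 * Real.pi), (v θ).toENNReal ∂volume : ENNReal) : EReal)
    - ((⨍⁻ θ in Ioc 0 (2 * Real.pi), (-v θ).toENNReal ∂volume : ENNReal) : EReal)

/-- Plurisubharmonicity on `Ω` of a function with values in `[-∞, +∞)`: upper semicontinuity, and
the sub-mean value inequality on the boundary of every closed disc, contained in `Ω`, of every
complex line. (The constant `-∞` is allowed.) -/
structure IsPSH {V : Type*} [NormedAddCommGroup V] [NormedSpace ℂ V]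
    (Ω : Set V) (u : V → EReal) : Prop where
  lt_top : ∀ a ∈ Ω, u a < ⊤
  usc : UpperSemicontinuousOn u Ω
  submean : ∀ a b : V, (∀ ζ : ℂ, ‖ζ‖ ≤ 1 → a + ζ • b ∈ Ω) →
    u a ≤ angularMean (fun θ => u (a + circleMap 0 1 θ • b))

/-- The `p`-uniform growth conditions, `1 < p < ∞`. -/
def UniformGrowth {n : ℕ} (p : ℝ) (φ : bdry → Cn n → ℝ) : Prop :=
  ∃ c C A : ℝ, 0 < c ∧ 0 < C ∧ 0 < A ∧
    ∀ (s : bdry) (w : Cn n), c * ‖w‖ ^ p - A ≤ φ s w ∧ φ s w ≤ C * ‖w‖ ^ p + A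

/-- The relation `ψ ≼ φ` on `∂𝔻 × ℂⁿ`: for almost every `s` and every `z`, the `limsup` of
`ψ (r s, w)` as `(r, w) → (1, z)`, `r < 1`, is at most `φ (s, z)`. -/
def BoundaryLE {n : ℕ} (ψ : ℂ × Cn n → ℝ) (φ : bdry → Cn n → ℝ) : Prop :=
  ∀ᵐ θ : ℝ, ∀ z : Cn n,
    limsup (fun q : ℝ × Cn n => ((ψ ((q.1 : ℂ) * (bdryPt θ : ℂ), q.2) : ℝ) : EReal))
      (𝓝[<] (1 : ℝ) ×ˢ 𝓝 z) ≤ ((φ (bdryPt θ) z : ℝ) : EReal)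

/-- The competitors for the upper envelope: real-valued plurisubharmonic functions `ψ` on
`𝔻 × ℂⁿ` with `ψ (t, z) ≤ sup_s φ (s, z)` and `ψ ≼ φ`. -/
structure IsCompetitor {n : ℕ} (φ : bdry → Cn n → ℝ) (ψ : ℂ × Cn n → ℝ) : Prop where
  psh : IsPSH (disc ×ˢ (univ : Set (Cn n))) (fun x => ((ψ x : ℝ) : EReal))
  le_sup : ∀ t ∈ disc, ∀ z : Cn n,
    ((ψ (t, z) : ℝ) : EReal) ≤ ⨆ s : bdry, ((φ s z : ℝ) : EReal)
  bdry_le : BoundaryLE ψ φ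

/-- The values at `(t, z)` of the competitors. -/
def competitorValues {n : ℕ} (φ : bdry → Cn n → ℝ) (t : ℂ) (z : Cn n) : Set ℝ :=
  {x | ∃ ψ : ℂ × Cn n → ℝ, IsCompetitor φ ψ ∧ ψ (t, z) = x}

/-- The interpolant `[φ]` of the boundary data `φ`: the Perron–Bremermann upper envelope. -/
def interp {n : ℕ} (φ : bdry → Cn n → ℝ) (t : ℂ) (z : Cn n) : ℝ :=
  sSup (competitorValues φ t z)

end

end PshInterp

namespace PshInterp

noncomputable section

/-! Write `P(t, z)` for the Poisson integral of `φ(·, z)` at `t`. The competitors are exactly the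
real-valued plurisubharmonic functions lying below `P` on `𝔻 × ℂⁿ`. A competitor lies below `P`
(`le_poissonInt`): on the slice `z` = const, dilated by `r < 1`, it is dominated by its own Poisson
integral, and the boundary condition is used as `r → 1`. Conversely `P` takes the boundary values
`φ` (`ae_tendsto_poissonInt`): Fatou's theorem gives this for a dense sequence of `z`, and convexity
makes `φ(s, ·)` locally Lipschitz uniformly in `s`, which reaches all `z` and all approaches `w →
z`.

Since `P` is continuous, the upper semicontinuous regularization of the envelope is still below `P`.
It is plurisubharmonic, hence itself a competitor, hence equal to the envelope (`interpStar_eq`). So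
`[φ]` is plurisubharmonic. It is homogeneous because `z ↦ λz` multiplies `P` by `|λ|^p` and so
permutes the competitors up to that factor.

Parts (ii) and (iii) hold for any nonnegative plurisubharmonic `w` with this homogeneity. The tool
is the maximum principle on holomorphic graphs (`IsPSH.le_re_polynomial`) together with the twist
`w(t, e^{-g/p} z) = e^{-Re g} w(t, z)`. For (ii), `log w ≤ Re q` on a circle means that the twist by
`q` is at most `1` there, hence also at the centre; Poisson integrals are infima of such `Re q`. For
(iii), let `w = Re F` along the graph of `h` and `Q = Re (F - F(0))`. Twisting by `δ(F - F(0))`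
gives `w₀ ≤ mean of e^{-δQ}(w₀ + Q) = w₀ - δ · mean(Q²) + O(δ²)` on each circle about `0`, so `Q`
vanishes. -/

/-! ### Circle averages as integrals over a probability measure -/

/-- The normalized Lebesgue measure on the angles `(0, 2π]`. -/
def angMeas : Measure ℝ :=
  (volume.restrict (Ioc 0 (2 * Real.pi)) univ)⁻¹ • volume.restrict (Ioc 0 (2 * Real.pi))

instance : IsProbabilityMeasure angMeas := by
  constructor
  have h : (volume.restrict (Ioc 0 (2 * Real.pi))) univ = ENNReal.ofReal (2 * Real.pi) := by simp
  rw [angMeas, Measure.smul_apply, smul_eq_mul, h]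
  exact ENNReal.inv_mul_cancel (by simp [Real.pi_pos]) ENNReal.ofReal_ne_top

theorem ae_angMeas {P : ℝ → Prop} (h : ∀ᵐ θ : ℝ, P θ) : ∀ᵐ θ ∂angMeas, P θ :=
  (Measure.smul_absolutelyContinuous (c := (volume.restrict (Ioc 0 (2 * Real.pi)) univ)⁻¹)).ae_le
    (ae_restrict_of_ae h)

theorem integral_angMeas (g : ℝ → ℝ) :
    ∫ θ, g θ ∂angMeas = (2 * Real.pi)⁻¹ * ∫ θ in (0 : ℝ)..(2 * Real.pi), g θ := by
  rw [angMeas, integral_smul_measure, intervalIntegral.integral_of_le Real.two_pi_pos.le]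
  simp [Real.pi_pos.le]

theorem circleAverage_eq_integral_angMeas (g : ℂ → ℝ) :
    Real.circleAverage g 0 1 = ∫ θ, g (circleMap 0 1 θ) ∂angMeas := by
  rw [integral_angMeas, Real.circleAverage_def, smul_eq_mul]

theorem angularMean_eq (v : ℝ → EReal) : angularMean v =
    ((∫⁻ θ, (v θ).toENNReal ∂angMeas : ENNReal) : EReal)
      - ((∫⁻ θ, (-v θ).toENNReal ∂angMeas : ENNReal) : EReal) := rfl

theorem angularMean_mono {v w : ℝ → EReal} (h : ∀ θ, v θ ≤ w θ) :
    angularMean v ≤ angularMean w := by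
  rw [angularMean_eq, angularMean_eq]
  refine EReal.sub_le_sub ?_ ?_
  · exact EReal.coe_ennreal_le_coe_ennreal_iff.2
      (lintegral_mono fun θ => EReal.toENNReal_le_toENNReal (h θ))
  · exact EReal.coe_ennreal_le_coe_ennreal_iff.2
      (lintegral_mono fun θ => EReal.toENNReal_le_toENNReal (EReal.neg_le_neg_iff.2 (h θ)))

theorem angularMean_coe {g : ℝ → ℝ} (hg : Integrable g angMeas) :
    angularMean (fun θ => (g θ : EReal)) = ((∫ θ, g θ ∂angMeas : ℝ) : EReal) := by
  have hfin {f : ℝ → ℝ} (hf : Integrable f angMeas) :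
      ∫⁻ θ, ENNReal.ofReal (f θ) ∂angMeas ≠ ⊤ := hf.lintegral_lt_top.ne
  rw [angularMean_eq, integral_eq_lintegral_pos_part_sub_lintegral_neg_part hg, EReal.coe_sub,
    EReal.coe_ennreal_toReal (hfin hg),
    EReal.coe_ennreal_toReal (show ∫⁻ θ, ENNReal.ofReal (-g θ) ∂angMeas ≠ ⊤ from hfin hg.neg)]
  rfl

theorem integrable_angMeas_of_bound {g : ℝ → ℝ} (hm : Measurable g) {C : ℝ}
    (hC : ∀ θ, |g θ| ≤ C) : Integrable g angMeas :=
  Integrable.of_bound hm.aestronglyMeasurable C (Eventually.of_forall hC)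

theorem integrable_angMeas_of_continuous {g : ℝ → ℝ} (hg : Continuous g) :
    Integrable g angMeas := by
  refine Integrable.smul_measure ?_ (by simp [Real.pi_pos])
  exact (hg.integrableOn_Icc (a := 0) (b := 2 * Real.pi)).mono_set Ioc_subset_Icc_self

/-! ### Density of real parts of polynomials on the circle -/

/-- Trigonometric polynomials, as sums of a holomorphic and an antiholomorphic polynomial. -/
theorem exists_polynomials_of_mem_span_fourier {P : C(AddCircle (2 * Real.pi), ℂ)}
    (hP : P ∈ Submodule.span ℂ (range (fourier (T := 2 * Real.pi)))) :
    ∃ A B : Polynomial ℂ, ∀ x : AddCircle (2 * Real.pi),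
      P x = A.eval (AddCircle.toCircle x : ℂ)
        + (starRingEnd ℂ) (B.eval (AddCircle.toCircle x : ℂ)) := by
  induction hP using Submodule.span_induction with
  | mem P hP =>
    obtain ⟨n, rfl⟩ := hP
    obtain ⟨m, rfl | rfl⟩ := n.eq_nat_or_neg
    · refine ⟨Polynomial.X ^ m, 0, fun x => ?_⟩
      simp [AddCircle.toCircle_nsmul]
    · refine ⟨0, Polynomial.X ^ m, fun x => ?_⟩
      rw [fourier_neg]
      simp [AddCircle.toCircle_nsmul]
  | zero => exact ⟨0, 0, fun x => by simp⟩
  | add P Q _ _ hP hQ =>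
    obtain ⟨A, B, h⟩ := hP
    obtain ⟨A', B', h'⟩ := hQ
    refine ⟨A + A', B + B', fun x => ?_⟩
    simp [h x, h' x]; ring
  | smul c P _ hP =>
    obtain ⟨A, B, h⟩ := hP
    refine ⟨Polynomial.C c * A, Polynomial.C ((starRingEnd ℂ) c) * B, fun x => ?_⟩
    simp [h x]; ring

/-- Real parts of complex polynomials are uniformly dense in the continuous functions on the
unit circle. -/
theorem exists_polynomial_re_near {g : ℂ → ℝ} (hg : Continuous g) {ε : ℝ} (hε : 0 < ε) :
    ∃ q : Polynomial ℂ, ∀ z ∈ Metric.sphere (0 : ℂ) 1, |(q.eval z).re - g z| < ε := by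
  have : Fact (0 < 2 * Real.pi) := ⟨Real.two_pi_pos⟩
  let G : C(AddCircle (2 * Real.pi), ℂ) :=
    ⟨fun x => (g (AddCircle.toCircle x : ℂ) : ℂ), by
      have := AddCircle.continuous_toCircle (T := 2 * Real.pi)
      fun_prop⟩
  have hG : G ∈ (Submodule.span ℂ
      (range (fourier (T := 2 * Real.pi)))).topologicalClosure := by
    rw [span_fourier_closure_eq_top]; trivial
  obtain ⟨P, hP, hd⟩ := Metric.mem_closure_iff.1 hG ε hε
  obtain ⟨A, B, hAB⟩ := exists_polynomials_of_mem_span_fourier hP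
  -- On the circle `P` is `A` plus the conjugate of `B`, which has the same real part as `A + B`.
  refine ⟨A + B, fun z hz => ?_⟩
  obtain ⟨x, hx⟩ := (AddCircle.homeomorphCircle (T := 2 * Real.pi) Real.two_pi_pos.ne').surjective
    ⟨z, by simpa [Submonoid.unitSphere] using hz⟩
  have hxz : (AddCircle.toCircle x : ℂ) = z := by
    rw [AddCircle.homeomorphCircle_apply] at hx
    rw [hx]
  have h1 : ‖G x - P x‖ < ε := by
    rw [← dist_eq_norm]; exact (ContinuousMap.dist_apply_le_dist x).trans_lt hd
  have h2 : ((A + B).eval z).re - g z = -(G x - P x).re := by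
    rw [hAB x, hxz]
    simp [G, hxz]
  rw [h2, abs_neg]
  exact (Complex.abs_re_le_norm _).trans_lt h1

/-! ### The Poisson kernel -/

/-- The Poisson kernel of the unit disc, as a function of the angle. -/
def pk (w : ℂ) (θ : ℝ) : ℝ := poissonKernel 0 w (circleMap 0 1 θ)

theorem pk_eq (w : ℂ) (θ : ℝ) :
    pk w θ = (1 - ‖w‖ ^ 2) / ‖circleMap 0 1 θ - w‖ ^ 2 := by
  simp [pk, poissonKernel]

theorem circleMap_sub_ne_zero {w : ℂ} (hw : ‖w‖ < 1) (θ : ℝ) : circleMap 0 1 θ - w ≠ 0 := by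
  intro h
  have h1 : ‖circleMap 0 1 θ‖ = 1 := by simp
  rw [sub_eq_zero.1 h] at h1
  exact hw.ne h1

theorem pk_nonneg {w : ℂ} (hw : ‖w‖ < 1) (θ : ℝ) : 0 ≤ pk w θ := by
  rw [pk_eq]
  have : 0 ≤ 1 - ‖w‖ ^ 2 := by nlinarith [norm_nonneg w]
  positivity

theorem continuousOn_pk : ContinuousOn (fun x : ℂ × ℝ => pk x.1 x.2)
    (Metric.ball (0 : ℂ) 1 ×ˢ univ) := by
  simp only [pk_eq]
  have : Continuous fun θ : ℝ => circleMap 0 1 θ := continuous_circleMap 0 1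
  refine ContinuousOn.div (by fun_prop) (by fun_prop) ?_
  rintro ⟨w, θ⟩ ⟨hw, -⟩
  have := circleMap_sub_ne_zero (mem_ball_zero_iff.1 hw) θ
  simpa using this

theorem continuous_pk {w : ℂ} (hw : ‖w‖ < 1) : Continuous (pk w) := by
  rw [← continuousOn_univ]
  exact continuousOn_pk.comp (f := fun θ : ℝ => (w, θ)) (by fun_prop)
    fun θ _ => ⟨mem_ball_zero_iff.2 hw, mem_univ _⟩

theorem pk_le {w : ℂ} {ρ : ℝ} (hρ : ρ < 1) (hw : ‖w‖ ≤ ρ) (θ : ℝ) :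
    pk w θ ≤ 1 / (1 - ρ) ^ 2 := by
  rw [pk_eq]
  have h1 : 1 - ρ ≤ ‖circleMap 0 1 θ - w‖ := by
    have := norm_sub_norm_le (circleMap 0 1 θ) w
    simp at this
    linarith
  have h2 : 0 < 1 - ρ := by linarith
  exact div_le_div₀ zero_le_one (by nlinarith [sq_nonneg ‖w‖]) (by positivity) (by gcongr)

theorem measurable_pk (w : ℂ) : Measurable (pk w) := by
  have : Measurable fun θ : ℝ => circleMap 0 1 θ := (continuous_circleMap 0 1).measurable
  have h : pk w = fun θ => (1 - ‖w‖ ^ 2) / ‖circleMap 0 1 θ - w‖ ^ 2 := funext (pk_eq w)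
  rw [h]
  fun_prop

theorem integrable_pk_mul {w : ℂ} (hw : ‖w‖ < 1) {g : ℝ → ℝ} (hg : Measurable g) {C : ℝ}
    (hC : ∀ θ, |g θ| ≤ C) : Integrable (fun θ => pk w θ * g θ) angMeas := by
  refine integrable_angMeas_of_bound ((measurable_pk w).mul hg) (C := 1 / (1 - ‖w‖) ^ 2 * C) ?_
  intro θ
  rw [abs_mul, abs_of_nonneg (pk_nonneg hw θ)]
  exact mul_le_mul (pk_le hw le_rfl θ) (hC θ) (abs_nonneg _) (by positivity)

theorem integral_pk {w : ℂ} (hw : ‖w‖ < 1) : ∫ θ, pk w θ ∂angMeas = 1 := by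
  have h := DiffContOnCl.circleAverage_poissonKernel_smul (f := fun _ => (1 : ℂ)) (c := 0) (R := 1)
    (w := w) diffContOnCl_const (by simpa using hw)
  have h2 : Real.circleAverage (poissonKernel 0 w) 0 1 = 1 := by
    have h3 := Complex.reCLM.circleAverage_comp_comm
      (f := poissonKernel 0 w • fun _ => (1 : ℂ)) (c := 0) (R := 1) (by
        refine ContinuousOn.circleIntegrable zero_le_one ?_
        refine ContinuousOn.smul ?_ continuousOn_const
        rw [poissonKernel_eq_re_herglotzRieszKernel]
        refine Complex.continuous_re.comp_continuousOn ?_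
        simpa using continuousOn_herglotzRieszKernel_sphere (c := 0) (R := 1) (w := w)
          (by simpa using hw))
    rw [h] at h3
    have h4 : (Complex.reCLM ∘ (poissonKernel 0 w • fun _ => (1 : ℂ))) = poissonKernel 0 w := by
      ext z; simp
    rw [h4] at h3
    simpa using h3
  rwa [circleAverage_eq_integral_angMeas] at h2

theorem integral_pk_mul_re_polynomial {w : ℂ} (hw : ‖w‖ < 1) (q : Polynomial ℂ) :
    ∫ θ, pk w θ * (q.eval (circleMap 0 1 θ)).re ∂angMeas = (q.eval w).re := by
  have h := DiffContOnCl.circleAverage_poissonKernel_smul (f := fun z => q.eval z) (c := 0) (R := 1)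
    (w := w) q.differentiable.diffContOnCl (by simpa using hw)
  have h3 := Complex.reCLM.circleAverage_comp_comm
      (f := poissonKernel 0 w • fun z => q.eval z) (c := 0) (R := 1) (by
        refine ContinuousOn.circleIntegrable zero_le_one ?_
        refine ContinuousOn.smul ?_ q.continuous.continuousOn
        rw [poissonKernel_eq_re_herglotzRieszKernel]
        refine Complex.continuous_re.comp_continuousOn ?_
        simpa using continuousOn_herglotzRieszKernel_sphere (c := 0) (R := 1) (w := w)
          (by simpa using hw))
  rw [h, circleAverage_eq_integral_angMeas] at h3
  simpa [pk] using h3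

theorem pk_zero (θ : ℝ) : pk 0 θ = 1 := by simp [pk_eq]

/-! ### Poisson integrals of upper semicontinuous functions as infima over polynomials -/

/-- The Lipschitz regularization from above of a function on a set. -/
def supConv (v : ℂ → ℝ) (k : ℕ) (x : ℂ) : ℝ :=
  ⨆ y : Metric.sphere (0 : ℂ) 1, (v y - k * ‖x - y‖)

section supConv

variable {v : ℂ → ℝ} {M : ℝ}

theorem bddAbove_supConv (hM : ∀ z ∈ Metric.sphere (0 : ℂ) 1, |v z| ≤ M) (k : ℕ) (x : ℂ) :
    BddAbove (range fun y : Metric.sphere (0 : ℂ) 1 => v y - k * ‖x - y‖) := by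
  refine ⟨M, ?_⟩
  rintro _ ⟨y, rfl⟩
  have := (abs_le.1 (hM y y.2)).2
  have : 0 ≤ (k : ℝ) * ‖x - y‖ := by positivity
  dsimp only
  linarith

theorem le_supConv (hM : ∀ z ∈ Metric.sphere (0 : ℂ) 1, |v z| ≤ M) (k : ℕ) {x : ℂ}
    (hx : x ∈ Metric.sphere (0 : ℂ) 1) : v x ≤ supConv v k x := by
  have := le_ciSup (bddAbove_supConv hM k x) ⟨x, hx⟩
  simpa [supConv] using this

instance : Nonempty (Metric.sphere (0 : ℂ) 1) := ⟨⟨1, by simp⟩⟩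

theorem supConv_le (hM : ∀ z ∈ Metric.sphere (0 : ℂ) 1, |v z| ≤ M) (k : ℕ) (x : ℂ) :
    supConv v k x ≤ M := by
  refine ciSup_le fun y => ?_
  have := (abs_le.1 (hM y y.2)).2
  have : 0 ≤ (k : ℝ) * ‖x - y‖ := by positivity
  linarith

theorem continuous_supConv (hM : ∀ z ∈ Metric.sphere (0 : ℂ) 1, |v z| ≤ M) (k : ℕ) :
    Continuous (supConv v k) := by
  have h : LipschitzWith k (supConv v k) := by
    refine LipschitzWith.of_le_add_mul _ fun x x' => ?_
    refine ciSup_le fun y => ?_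
    have h1 := le_ciSup (bddAbove_supConv hM k x') y
    have h2 : ‖x' - y‖ ≤ ‖x - y‖ + dist x x' := by
      rw [dist_comm, dist_eq_norm, add_comm]
      exact norm_sub_le_norm_sub_add_norm_sub _ _ _
    have h3 : (k : ℝ) * ‖x' - y‖ ≤ k * (‖x - y‖ + dist x x') := by gcongr
    change v y - k * ‖x - y‖ ≤ supConv v k x' + _
    change v y - k * ‖x' - y‖ ≤ supConv v k x' at h1
    push_cast
    linarith
  exact h.continuous

theorem tendsto_supConv (hM : ∀ z ∈ Metric.sphere (0 : ℂ) 1, |v z| ≤ M)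
    (husc : UpperSemicontinuousOn v (Metric.sphere (0 : ℂ) 1)) {x : ℂ}
    (hx : x ∈ Metric.sphere (0 : ℂ) 1) :
    Tendsto (fun k => supConv v k x) atTop (𝓝 (v x)) := by
  refine tendsto_order.2 ⟨fun c hc => Eventually.of_forall fun k =>
    hc.trans_le (le_supConv hM k hx), fun c hc => ?_⟩
  obtain ⟨c', hc1, hc2⟩ := exists_between hc
  obtain ⟨δ, hδ, h⟩ := Metric.mem_nhdsWithin_iff.1 (husc x hx c' hc1)
  -- From slope `N` on, a point at distance at least `δ` contributes less than `c'`; nearer points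
  -- do so by upper semicontinuity.
  obtain ⟨N, hN⟩ := exists_nat_gt ((M - c') / δ)
  filter_upwards [eventually_ge_atTop N] with k hk
  refine lt_of_le_of_lt (ciSup_le fun y => ?_) hc2
  have hk0 : 0 ≤ (k : ℝ) * ‖x - y‖ := by positivity
  by_cases hy : dist (y : ℂ) x < δ
  · have : v y < c' := h ⟨hy, y.2⟩
    linarith
  · rw [not_lt, dist_comm, dist_eq_norm] at hy
    have h1 := (abs_le.1 (hM y y.2)).2
    have h2 : (M - c') < N * δ := (div_lt_iff₀ hδ).1 hN
    have h3 : (N : ℝ) * δ ≤ k * ‖x - y‖ := by gcongr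
    linarith

end supConv

theorem circleMap_mem_unit (θ : ℝ) : circleMap 0 1 θ ∈ Metric.sphere (0 : ℂ) 1 :=
  circleMap_mem_sphere 0 zero_le_one θ

theorem measurable_comp_circleMap {v : ℂ → ℝ}
    (husc : UpperSemicontinuousOn v (Metric.sphere (0 : ℂ) 1)) :
    Measurable fun θ => v (circleMap 0 1 θ) := by
  have h : UpperSemicontinuous fun θ => v (circleMap 0 1 θ) := by
    rw [← upperSemicontinuousOn_univ_iff]
    exact husc.comp (continuous_circleMap 0 1).continuousOn fun θ _ => circleMap_mem_unit θ
  exact h.measurable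

/-- A number that is at most `Re q (w)` for every polynomial `q` with `v ≤ Re q` on the circle is at
most the Poisson integral of `v` at `w`. -/
theorem le_poisson_of_forall_polynomial {v : ℂ → ℝ} {M : ℝ}
    (hM : ∀ z ∈ Metric.sphere (0 : ℂ) 1, |v z| ≤ M)
    (husc : UpperSemicontinuousOn v (Metric.sphere (0 : ℂ) 1)) {w : ℂ} (hw : ‖w‖ < 1) {c : ℝ}
    (h : ∀ q : Polynomial ℂ, (∀ z ∈ Metric.sphere (0 : ℂ) 1, v z ≤ (q.eval z).re) →
      c ≤ (q.eval w).re) :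
    c ≤ ∫ θ, pk w θ * v (circleMap 0 1 θ) ∂angMeas := by
  have hpoly : ∀ g : ℂ → ℝ, Continuous g → (∀ z ∈ Metric.sphere (0 : ℂ) 1, v z ≤ g z) →
      c ≤ ∫ θ, pk w θ * g (circleMap 0 1 θ) ∂angMeas := by
    intro g hg hvg
    refine le_of_forall_pos_le_add fun ε hε => ?_
    -- Aiming at `g + ε / 2` with error `ε / 2` forces `g ≤ Re q ≤ g + ε` on the circle, so `q` is
    -- admissible.
    obtain ⟨q, hq⟩ := exists_polynomial_re_near (g := fun z => g z + ε / 2) (by fun_prop)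
      (half_pos hε)
    refine (h q fun z hz => ?_).trans ?_
    · have := (abs_lt.1 (hq z hz)).1
      have := hvg z hz
      linarith
    · have hcc : Continuous fun θ => g (circleMap 0 1 θ) := hg.comp (continuous_circleMap 0 1)
      have hone : ε = ∫ θ, ε * pk w θ ∂angMeas := by
        rw [integral_const_mul, integral_pk hw, mul_one]
      rw [← integral_pk_mul_re_polynomial hw q, hone, ← integral_add]
      · refine integral_mono ?_ ?_ fun θ => ?_
        · exact integrable_angMeas_of_continuous ((continuous_pk hw).mul
            (Complex.continuous_re.comp (q.continuous.comp (continuous_circleMap 0 1))))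
        · exact integrable_angMeas_of_continuous (((continuous_pk hw).mul hcc).add
            (continuous_const.mul (continuous_pk hw)))
        · have h1 := (abs_lt.1 (hq _ (circleMap_mem_unit θ))).2
          have h2 : (q.eval (circleMap 0 1 θ)).re ≤ g (circleMap 0 1 θ) + ε := by linarith
          have := mul_le_mul_of_nonneg_left h2 (pk_nonneg hw θ)
          dsimp only
          linarith
      · exact integrable_angMeas_of_continuous ((continuous_pk hw).mul hcc)
      · exact integrable_angMeas_of_continuous (continuous_const.mul (continuous_pk hw))
  have hlim : Tendsto (fun k => ∫ θ, pk w θ * supConv v k (circleMap 0 1 θ) ∂angMeas) atTop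
      (𝓝 (∫ θ, pk w θ * v (circleMap 0 1 θ) ∂angMeas)) := by
    refine tendsto_integral_of_dominated_convergence (fun _ => 1 / (1 - ‖w‖) ^ 2 * M)
      (fun k => ?_) (integrable_const _) (fun k => ?_) ?_
    · exact ((continuous_pk hw).mul
        ((continuous_supConv hM k).comp (continuous_circleMap 0 1))).aestronglyMeasurable
    · refine Eventually.of_forall fun θ => ?_
      rw [Real.norm_eq_abs, abs_mul, abs_of_nonneg (pk_nonneg hw θ)]
      refine mul_le_mul (pk_le hw le_rfl θ) ?_ (abs_nonneg _) (by positivity)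
      refine abs_le.2 ⟨?_, supConv_le hM k _⟩
      exact (abs_le.1 (hM _ (circleMap_mem_unit θ))).1.trans (le_supConv hM k (circleMap_mem_unit θ))
    · exact Eventually.of_forall fun θ =>
        (tendsto_supConv hM husc (circleMap_mem_unit θ)).const_mul _
  exact ge_of_tendsto' hlim fun k => hpoly _ (continuous_supConv hM k) fun z hz => le_supConv hM k hz

/-! ### Maximum principle along holomorphic graphs -/

section

theorem upperSemicontinuousOn_coe_ereal {X : Type*} [TopologicalSpace X] {u : X → ℝ} {Ω : Set X} :
    UpperSemicontinuousOn (fun x => (u x : EReal)) Ω ↔ UpperSemicontinuousOn u Ω := by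
  constructor
  · intro h x hx c hc
    filter_upwards [h x hx (c : EReal) (EReal.coe_lt_coe_iff.2 hc)] with y hy
    exact EReal.coe_lt_coe_iff.1 hy
  · intro h x hx c hc
    obtain ⟨c', h1, h2⟩ := EReal.lt_iff_exists_real_btwn.1 hc
    filter_upwards [h x hx c' (EReal.coe_lt_coe_iff.1 h1)] with y hy
    exact (EReal.coe_lt_coe_iff.2 hy).trans h2

theorem integral_re_circle {F : ℂ → ℂ} (hF : DiffContOnCl ℂ F (Metric.ball 0 1)) :
    ∫ θ, (F (circleMap 0 1 θ)).re ∂angMeas = (F 0).re := by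
  have h1 : ContinuousOn F (Metric.sphere 0 1) := by
    refine hF.continuousOn.mono ?_
    rw [closure_ball _ one_ne_zero]
    exact Metric.sphere_subset_closedBall
  have h := Complex.reCLM.circleAverage_comp_comm (h1.circleIntegrable zero_le_one)
  rw [circleAverage_eq_integral_angMeas, DiffContOnCl.circleAverage (by simpa using hF)] at h
  simpa using h

variable {n : ℕ} {u : ℂ × Cn n → ℝ}

/-- A plurisubharmonic function, tested along the perturbed graph of a holomorphic map, has no
interior maximum after adding a strictly subharmonic weight. -/
theorem IsPSH.not_local_max (hu : IsPSH (disc ×ˢ (univ : Set (Cn n))) (fun x => (u x : EReal)))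
    {a b : ℂ} (hab : ∀ ζ : ℂ, ‖ζ‖ ≤ 1 → a + ζ * b ∈ disc) {f : ℂ → Cn n}
    {ζ₁ : ℂ} (hζ₁ : ‖ζ₁‖ < 1) (hf : ∀ᶠ ζ in 𝓝 ζ₁, DifferentiableAt ℂ f ζ) (v₁ : Cn n)
    (q : Polynomial ℂ) {K ε : ℝ} (hK : 0 ≤ K) (hε : 0 < ε) {m : ℝ}
    (hm : ∀ᶠ x : ℂ × Cn n in 𝓝 (ζ₁, v₁),
      u (a + x.1 * b, f x.1 + x.2) - (q.eval x.1).re - K * ‖x.2‖ ^ 2 + ε * ‖x.1‖ ^ 2 ≤ m)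
    (hm₁ : m = u (a + ζ₁ * b, f ζ₁ + v₁) - (q.eval ζ₁).re - K * ‖v₁‖ ^ 2 + ε * ‖ζ₁‖ ^ 2) :
    False := by
  set L := deriv f ζ₁ with hL
  -- `R` is the deviation of the graph from its tangent line. Sub-mean values are only available on
  -- affine discs, so the tangent disc is used and `R` is absorbed into the free variable `v`.
  let R : ℂ → Cn n := fun τ => f (ζ₁ + τ) - f ζ₁ - τ • L
  have hfd : HasDerivAt f L ζ₁ := hf.self_of_nhds.hasDerivAt
  have hR0 : R 0 = 0 := by simp [R]
  have hadd : Tendsto (fun τ : ℂ => ζ₁ + τ) (𝓝 0) (𝓝 ζ₁) := by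
    have : Continuous fun τ : ℂ => ζ₁ + τ := by fun_prop
    simpa using this.tendsto 0
  have hRd : ∀ᶠ τ in 𝓝 (0 : ℂ), DifferentiableAt ℂ R τ := by
    filter_upwards [hadd.eventually hf] with τ hτ
    have : DifferentiableAt ℂ (fun τ => f (ζ₁ + τ)) τ :=
      DifferentiableAt.comp (f := fun τ : ℂ => ζ₁ + τ) τ hτ (by fun_prop)
    fun_prop
  have hRc : ContinuousAt R 0 := hRd.self_of_nhds.continuousAt
  -- This makes the penalty `K ‖R τ‖ ^ 2` smaller than the gain `ε ‖τ‖ ^ 2`.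
  obtain ⟨η, hη0, hη⟩ : ∃ η : ℝ, 0 < η ∧ K * η ^ 2 < ε := by
    refine ⟨Real.sqrt (ε / (K + 1)), by positivity, ?_⟩
    rw [Real.sq_sqrt (by positivity), mul_div_assoc', div_lt_iff₀ (by positivity)]
    nlinarith
  have hRo : ∀ᶠ τ in 𝓝 (0 : ℂ), ‖R τ‖ ≤ η * ‖τ‖ := by
    have := (hasDerivAt_iff_isLittleO_nhds_zero.1 hfd).def hη0
    simpa [R] using this
  have hpath : Tendsto (fun τ : ℂ => (ζ₁ + τ, v₁ - R τ)) (𝓝 0) (𝓝 (ζ₁, v₁)) := by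
    have h1 : Tendsto (fun τ => v₁ - R τ) (𝓝 0) (𝓝 (v₁ - R 0)) :=
      tendsto_const_nhds.sub hRc.tendsto
    rw [hR0, sub_zero] at h1
    exact hadd.prodMk_nhds h1
  have hball : ∀ᶠ τ in 𝓝 (0 : ℂ), ‖ζ₁ + τ‖ < 1 := by
    have : Continuous fun τ : ℂ => ‖ζ₁ + τ‖ := by fun_prop
    exact (this.tendsto' 0 ‖ζ₁‖ (by simp)).eventually_lt_const hζ₁
  obtain ⟨σ', hσ', hall⟩ := Metric.eventually_nhds_iff.1
    (hRd.and (hRo.and ((hpath.eventually hm).and hball)))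
  set σ := σ' / 2 with hσdef
  have hσ : 0 < σ := by positivity
  have hlt : ∀ ζ : ℂ, ‖ζ‖ ≤ 1 → dist ((σ : ℂ) * ζ) 0 < σ' := by
    intro ζ hζ
    rw [dist_zero_right, norm_mul, Complex.norm_real, Real.norm_of_nonneg hσ.le]
    nlinarith
  -- The terms with harmonic real part: `q` and the cross terms of `‖v₁ - R τ‖ ^ 2` and `‖ζ₁ + τ‖ ^
  -- 2`. Only `‖R τ‖ ^ 2` and `‖τ‖ ^ 2` remain outside.
  let Hol : ℂ → ℂ := fun τ => q.eval (ζ₁ + τ) - 2 * K * innerSL ℂ v₁ (R τ)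
    - 2 * ε * ((starRingEnd ℂ) ζ₁ * τ)
  have hHol : DiffContOnCl ℂ (fun ζ => Hol (σ * ζ)) (Metric.ball 0 1) := by
    refine DifferentiableOn.diffContOnCl fun ζ hζ => DifferentiableAt.differentiableWithinAt ?_
    rw [closure_ball _ one_ne_zero, mem_closedBall_zero_iff] at hζ
    have h1 : DifferentiableAt ℂ (fun ζ : ℂ => R (σ * ζ)) ζ :=
      DifferentiableAt.comp (f := fun ζ : ℂ => (σ : ℂ) * ζ) ζ (hall (hlt ζ hζ)).1 (by fun_prop)
    have h2 : DifferentiableAt ℂ (fun ζ : ℂ => q.eval (ζ₁ + σ * ζ)) ζ :=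
      DifferentiableAt.comp (f := fun ζ : ℂ => ζ₁ + (σ : ℂ) * ζ) ζ q.differentiableAt (by fun_prop)
    have h3 : DifferentiableAt ℂ (fun ζ : ℂ => innerSL ℂ v₁ (R (σ * ζ))) ζ :=
      (innerSL ℂ v₁).differentiableAt.comp ζ h1
    dsimp only [Hol]
    fun_prop
  have hbound : ∀ θ : ℝ, u ((a + ζ₁ * b, f ζ₁ + v₁) +
      circleMap 0 1 θ • ((σ * b, (σ : ℂ) • L) : ℂ × Cn n)) ≤
      m + K * ‖v₁‖ ^ 2 - ε * ‖ζ₁‖ ^ 2 + (K * η ^ 2 - ε) * σ ^ 2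
        + (Hol (σ * circleMap 0 1 θ)).re := by
    intro θ
    set τ : ℂ := σ * circleMap 0 1 θ with hτ
    have hτn : ‖τ‖ = σ := by simp [hτ, abs_of_pos hσ]
    obtain ⟨-, h2, h3, -⟩ := hall (hlt (circleMap 0 1 θ) (by simp))
    rw [← hτ] at h2 h3
    have hpt : ((a + ζ₁ * b, f ζ₁ + v₁) + circleMap 0 1 θ • ((σ * b, (σ : ℂ) • L) : ℂ × Cn n))
        = (a + (ζ₁ + τ) * b, f (ζ₁ + τ) + (v₁ - R τ)) := by
      refine Prod.ext ?_ ?_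
      · simp [hτ]; ring
      · simp only [R, Prod.snd_add, Prod.smul_snd, smul_smul, hτ, mul_comm]
        abel
    rw [hpt]
    have e1 : ‖v₁ - R τ‖ ^ 2 = ‖v₁‖ ^ 2 - 2 * (innerSL ℂ v₁ (R τ)).re + ‖R τ‖ ^ 2 := by
      rw [@norm_sub_sq ℂ]; simp
    have e2 : ‖ζ₁ + τ‖ ^ 2 = ‖ζ₁‖ ^ 2 + 2 * ((starRingEnd ℂ) ζ₁ * τ).re + ‖τ‖ ^ 2 := by
      rw [Complex.sq_norm, Complex.sq_norm, Complex.sq_norm, Complex.normSq_add]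
      simp only [Complex.mul_re, Complex.conj_re, Complex.conj_im]
      ring
    have e3 : ‖R τ‖ ^ 2 ≤ η ^ 2 * σ ^ 2 := by
      rw [← mul_pow, ← hτn]; gcongr
    have e4 : (Hol τ).re = (q.eval (ζ₁ + τ)).re - 2 * K * (innerSL ℂ v₁ (R τ)).re
        - 2 * ε * ((starRingEnd ℂ) ζ₁ * τ).re := by
      simp [Hol]
    have e5 := mul_le_mul_of_nonneg_left e3 hK
    dsimp only at h3
    rw [e1, e2, hτn] at h3
    rw [e4]
    linarith
  have hsub := hu.submean (a + ζ₁ * b, f ζ₁ + v₁) (σ * b, (σ : ℂ) • L) (fun ζ hζ => by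
    refine ⟨?_, mem_univ _⟩
    have h1 := hab (ζ₁ + σ * ζ) (hall (hlt ζ hζ)).2.2.2.le
    have h2 : a + (ζ₁ + σ * ζ) * b = a + ζ₁ * b + ζ * (σ * b) := by ring
    rw [h2] at h1
    simpa using h1)
  have hcont : Continuous fun θ : ℝ => (Hol (σ * circleMap 0 1 θ)).re := by
    refine Complex.continuous_re.comp ?_
    have := hHol.continuousOn
    rw [closure_ball _ one_ne_zero] at this
    exact this.comp_continuous (continuous_circleMap 0 1)
      fun θ => Metric.sphere_subset_closedBall (circleMap_mem_unit θ)
  -- The mean of `Hol.re` is its value at `0`, and everything cancels against the central value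
  -- except `(K * η ^ 2 - ε) * σ ^ 2 < 0`.
  have hle := hsub.trans (angularMean_mono fun θ => EReal.coe_le_coe_iff.2 (hbound θ))
  rw [angularMean_coe (integrable_angMeas_of_continuous (by fun_prop)), EReal.coe_le_coe_iff, integral_add (integrable_const _) (integrable_angMeas_of_continuous hcont),
    integral_re_circle hHol] at hle
  simp [Hol, hR0] at hle
  nlinarith [mul_pos (sub_pos.2 hη) (pow_pos hσ 2)]

/-- The maximum principle for a plurisubharmonic function on a holomorphic graph over a disc. -/
theorem IsPSH.le_re_polynomial
    (hu : IsPSH (disc ×ˢ (univ : Set (Cn n))) (fun x => (u x : EReal)))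
    {a b : ℂ} (hab : ∀ ζ : ℂ, ‖ζ‖ ≤ 1 → a + ζ * b ∈ disc) {f : ℂ → Cn n}
    (hf : DiffContOnCl ℂ f (Metric.ball 0 1)) (q : Polynomial ℂ)
    (h : ∀ ζ ∈ Metric.sphere (0 : ℂ) 1, u (a + ζ * b, f ζ) ≤ (q.eval ζ).re)
    {ζ₀ : ℂ} (hζ₀ : ‖ζ₀‖ < 1) : u (a + ζ₀ * b, f ζ₀) ≤ (q.eval ζ₀).re := by
  by_contra! hlt
  -- Half the gap: on `‖ζ‖ = 1` the weighted function stays below `ε + ε`, its value at `(ζ₀, 0)`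
  -- being at least `2 * ε`.
  set ε := (u (a + ζ₀ * b, f ζ₀) - (q.eval ζ₀).re) / 2 with hεdef
  have hε : 0 < ε := by rw [hεdef]; linarith
  have hfc : ContinuousOn f (Metric.closedBall 0 1) := by
    simpa [closure_ball _ one_ne_zero] using hf.continuousOn
  have hG : UpperSemicontinuousOn
      (fun x : ℂ × Cn n => u (a + x.1 * b, f x.1 + x.2) - (q.eval x.1).re)
      (Metric.closedBall 0 1 ×ˢ univ) := by
    have h1 : UpperSemicontinuousOn (fun x : ℂ × Cn n => u (a + x.1 * b, f x.1 + x.2))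
        (Metric.closedBall 0 1 ×ˢ univ) := by
      refine (upperSemicontinuousOn_coe_ereal.1 hu.usc).comp
        (g := fun x : ℂ × Cn n => (a + x.1 * b, f x.1 + x.2)) ?_ ?_
      · have : ContinuousOn (fun x : ℂ × Cn n => f x.1) (Metric.closedBall 0 1 ×ˢ univ) :=
          hfc.comp continuousOn_fst fun x hx => hx.1
        exact ContinuousOn.prodMk (by fun_prop) (this.add continuousOn_snd)
      · exact fun x hx => ⟨hab _ (mem_closedBall_zero_iff.1 hx.1), mem_univ _⟩
    have h2 : Continuous fun x : ℂ × Cn n => -(q.eval x.1).re :=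
      (Complex.continuous_re.comp (q.continuous.comp continuous_fst)).neg
    simpa only [sub_eq_add_neg] using h1.add h2.continuousOn.upperSemicontinuousOn
  obtain ⟨ρ, hρ, hρs⟩ : ∃ ρ > 0, ∀ v : Cn n, ‖v‖ ≤ ρ → ∀ ζ ∈ Metric.sphere (0 : ℂ) 1,
      u (a + ζ * b, f ζ + v) - (q.eval ζ).re < ε := by
    have h1 : ∀ᶠ v in 𝓝 (0 : Cn n), ∀ ζ ∈ Metric.sphere (0 : ℂ) 1,
        ζ ∈ Metric.closedBall (0 : ℂ) 1 → u (a + ζ * b, f ζ + v) - (q.eval ζ).re < ε := by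
      refine (isCompact_sphere (0 : ℂ) 1).eventually_forall_of_forall_eventually fun ζ hζ => ?_
      have h2 := hG (ζ, 0) ⟨Metric.sphere_subset_closedBall hζ, mem_univ _⟩ ε (by
        have := h ζ hζ
        simp only [add_zero]
        linarith)
      have h3 := eventually_nhdsWithin_iff.1 h2
      have h4 : Tendsto Prod.swap (𝓝 ((0 : Cn n), ζ)) (𝓝 (ζ, (0 : Cn n))) :=
        continuous_swap.tendsto _
      filter_upwards [h4.eventually h3] with x hx hx2
      exact hx ⟨hx2, mem_univ _⟩
    obtain ⟨ρ, hρ, h2⟩ := Metric.eventually_nhds_iff.1 h1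
    refine ⟨ρ / 2, half_pos hρ, fun v hv ζ hζ => h2 ?_ ζ hζ (Metric.sphere_subset_closedBall hζ)⟩
    rw [dist_zero_right]
    linarith
  set S : Set (ℂ × Cn n) := Metric.closedBall 0 1 ×ˢ Metric.closedBall 0 ρ with hS
  have hSc : IsCompact S := (isCompact_closedBall _ _).prod (isCompact_closedBall _ _)
  have hSsub : S ⊆ Metric.closedBall 0 1 ×ˢ univ := prod_mono_right (subset_univ _)
  have hmem : (ζ₀, (0 : Cn n)) ∈ S := ⟨mem_closedBall_zero_iff.2 hζ₀.le, by simp [hρ.le]⟩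
  have husc : ∀ K : ℝ, UpperSemicontinuousOn (fun x : ℂ × Cn n =>
      u (a + x.1 * b, f x.1 + x.2) - (q.eval x.1).re - K * ‖x.2‖ ^ 2 + ε * ‖x.1‖ ^ 2) S := by
    intro K
    have h2 : Continuous fun x : ℂ × Cn n => - (K * ‖x.2‖ ^ 2) + ε * ‖x.1‖ ^ 2 := by fun_prop
    have h3 := (hG.mono hSsub).add h2.continuousOn.upperSemicontinuousOn
    have h4 : ∀ x y z : ℝ, x - y + z = x + (-y + z) := fun x y z => by ring
    simpa only [h4] using h3
  obtain ⟨x₀, -, hx₀⟩ := (husc 0).exists_isMaxOn ⟨_, hmem⟩ hSc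
  set B := u (a + x₀.1 * b, f x₀.1 + x₀.2) - (q.eval x₀.1).re - 0 * ‖x₀.2‖ ^ 2 + ε * ‖x₀.1‖ ^ 2
  -- `B` is the maximum without penalty, so this `K` makes the penalized function nonpositive on
  -- `‖v‖ = ρ` and pushes the maximum inside.
  obtain ⟨K, hK0, hK⟩ : ∃ K : ℝ, 0 ≤ K ∧ B ≤ K * ρ ^ 2 := by
    refine ⟨|B| / ρ ^ 2, by positivity, ?_⟩
    rw [div_mul_cancel₀ _ (by positivity)]
    exact le_abs_self B
  obtain ⟨⟨ζ₁, v₁⟩, hx₁S, hx₁⟩ := (husc K).exists_isMaxOn ⟨_, hmem⟩ hSc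
  have hval := hx₁ hmem
  have hval0 := hx₀ hx₁S
  simp only [mem_ofPred_eq, add_zero, norm_zero] at hval hval0
  have hbig : 2 * ε ≤ u (a + ζ₁ * b, f ζ₁ + v₁) - (q.eval ζ₁).re - K * ‖v₁‖ ^ 2
      + ε * ‖ζ₁‖ ^ 2 := by
    have : 0 ≤ ε * ‖ζ₀‖ ^ 2 := by positivity
    have h2 : 2 * ε = u (a + ζ₀ * b, f ζ₀) - (q.eval ζ₀).re := by rw [hεdef]; ring
    nlinarith
  have hζ₁ : ‖ζ₁‖ < 1 := by
    refine lt_of_le_of_ne (mem_closedBall_zero_iff.1 hx₁S.1) fun h1 => ?_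
    have h2 := hρs v₁ (mem_closedBall_zero_iff.1 hx₁S.2) ζ₁ (by simpa using h1)
    rw [h1] at hbig
    have : 0 ≤ K * ‖v₁‖ ^ 2 := by positivity
    linarith
  have hv₁ : ‖v₁‖ < ρ := by
    refine lt_of_le_of_ne (mem_closedBall_zero_iff.1 hx₁S.2) fun h1 => ?_
    rw [h1] at hbig
    change u (a + ζ₁ * b, f ζ₁ + v₁) - (q.eval ζ₁).re - 0 * ‖v₁‖ ^ 2 + ε * ‖ζ₁‖ ^ 2 ≤ B at hval0
    linarith
  refine hu.not_local_max hab hζ₁ (f := f) ?_ v₁ q hK0 hε ?_ rfl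
  · filter_upwards [Metric.isOpen_ball.mem_nhds (mem_ball_zero_iff.2 hζ₁)] with ζ hζ
    exact hf.differentiableAt Metric.isOpen_ball hζ
  · have h1 : S ∈ 𝓝 (ζ₁, v₁) := prod_mem_nhds
      (mem_of_superset (Metric.isOpen_ball.mem_nhds (mem_ball_zero_iff.2 hζ₁))
        Metric.ball_subset_closedBall)
      (mem_of_superset (Metric.isOpen_ball.mem_nhds (mem_ball_zero_iff.2 hv₁))
        Metric.ball_subset_closedBall)
    filter_upwards [h1] with x hx
    exact hx₁ hx

end

/-! ### Fatou's theorem on radial limits -/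

/-- Take the least admissible `j`. If `j > 0`, minimality gives `|s| > 2 ^ (j - 1) * η`, and the
term `s ^ 2 / 5` alone yields the constant `2 * 5 * 4 = 40`. -/
theorem poisson_bound_dyadic {η : ℝ} (hη : 0 < η) (s : ℝ) :
    ∃ j : ℕ, |s| ≤ 2 ^ j * η ∧ 2 * η / (η ^ 2 + s ^ 2 / 5) ≤ 40 / 4 ^ j / η := by
  have hex : ∃ j : ℕ, |s| ≤ 2 ^ j * η := by
    obtain ⟨j, hj⟩ := pow_unbounded_of_one_lt (|s| / η) one_lt_two
    exact ⟨j, ((div_lt_iff₀ hη).1 hj).le⟩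
  classical
  refine ⟨Nat.find hex, Nat.find_spec hex, ?_⟩
  rw [div_div, div_le_div_iff₀ (by positivity) (by positivity)]
  rcases h : Nat.find hex with _ | j
  · nlinarith [sq_nonneg s, sq_nonneg η]
  · have h1 : ¬ |s| ≤ 2 ^ j * η := Nat.find_min hex (by omega)
    rw [not_le] at h1
    have h2 : (2 ^ j * η) ^ 2 ≤ s ^ 2 := by
      rw [← sq_abs s]; gcongr
    have h3 : (4 : ℝ) ^ (j + 1) = 4 * (2 ^ j) ^ 2 := by
      rw [← pow_mul, pow_succ, mul_comm j 2, pow_mul]; norm_num; ring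
    rw [h3]
    nlinarith [sq_nonneg η]

/-- The squared distance is `(1 - r) ^ 2 + 2 r (1 - cos (τ - θ))`; Jordan's type bound `cos x ≤ 1 -
2 x² / π²`, `2 r ≥ 1` and `π² ≤ 10` give the denominator. -/
theorem pk_le_near {r : ℝ} (hr : 1 / 2 ≤ r) (hr1 : r < 1) (θ : ℝ) {τ : ℝ}
    (h : |τ - θ| ≤ Real.pi) :
    pk (r * circleMap 0 1 θ) τ ≤ 2 * (1 - r) / ((1 - r) ^ 2 + (τ - θ) ^ 2 / 5) := by
  have h1 : ‖(r : ℂ) * circleMap 0 1 θ‖ = r := by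
    simp [abs_of_nonneg (by linarith : (0 : ℝ) ≤ r)]
  have h2 : ‖circleMap 0 1 τ - r * circleMap 0 1 θ‖ ^ 2
      = 1 - 2 * r * Real.cos (τ - θ) + r ^ 2 := by
    rw [Complex.sq_norm, Complex.normSq_apply, Real.cos_sub]
    simp [circleMap, Complex.exp_ofReal_mul_I_re, Complex.exp_ofReal_mul_I_im]
    nlinarith [Real.sin_sq_add_cos_sq τ, Real.sin_sq_add_cos_sq θ]
  rw [pk_eq, h1, h2]
  have h3 := Real.cos_le_one_sub_mul_cos_sq h
  have hpi : Real.pi ^ 2 ≤ 10 := by nlinarith [Real.pi_lt_d2, Real.pi_pos]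
  have h4 : 1 / 5 ≤ 2 / Real.pi ^ 2 := by
    rw [div_le_div_iff₀ (by norm_num) (by positivity)]; linarith
  have h5 : (τ - θ) ^ 2 / 5 ≤ 2 / Real.pi ^ 2 * (τ - θ) ^ 2 := by
    nlinarith [sq_nonneg (τ - θ)]
  have h6 : 0 ≤ (τ - θ) ^ 2 := sq_nonneg _
  have h7 : 0 < (1 - r) ^ 2 := by nlinarith
  refine div_le_div₀ (by nlinarith) (by nlinarith) (by positivity) ?_
  nlinarith

/-- The Poisson average of a nonnegative function is controlled by its averages over dyadic
intervals. -/
theorem integral_pk_mul_le_tsum {G : ℝ → ℝ} (hG : Measurable G) (hG0 : ∀ x, 0 ≤ G x) {C : ℝ}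
    (hGC : ∀ x, G x ≤ C) {r : ℝ} (hr : 1 / 2 ≤ r) (hr1 : r < 1) (θ : ℝ) :
    ∫ τ in Ioc (θ - Real.pi) (θ + Real.pi), pk (r * circleMap 0 1 θ) τ * G τ
      ≤ ∑' k : ℕ, 80 * (1 / 2) ^ k * ⨍ y in Metric.closedBall θ (2 ^ k * (1 - r)), G y := by
  set η := 1 - r with hη
  have hη0 : 0 < η := by linarith
  have hw : ‖(r : ℂ) * circleMap 0 1 θ‖ < 1 := by
    simpa [abs_of_nonneg (by linarith : (0 : ℝ) ≤ r)] using hr1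
  have hvol : ∀ k : ℕ, volume.real (Metric.closedBall θ (2 ^ k * η)) = 2 * (2 ^ k * η) := by
    intro k
    rw [Real.volume_real_closedBall (by positivity)]
  have hav : ∀ k : ℕ, ⨍ y in Metric.closedBall θ (2 ^ k * η), G y
      = (2 * (2 ^ k * η))⁻¹ * ∫ y in Metric.closedBall θ (2 ^ k * η), G y := by
    intro k
    rw [setAverage_eq, hvol, smul_eq_mul]
  have hint : ∀ k : ℕ, IntegrableOn G (Metric.closedBall θ (2 ^ k * η)) := fun k =>
    Measure.integrableOn_of_bounded (M := C) measure_closedBall_lt_top.ne hG.aestronglyMeasurable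
      (Eventually.of_forall fun x => by rw [Real.norm_of_nonneg (hG0 x)]; exact hGC x)
  have hav0 : ∀ k : ℕ, 0 ≤ ⨍ y in Metric.closedBall θ (2 ^ k * η), G y := fun k => by
    rw [hav]
    exact mul_nonneg (by positivity) (integral_nonneg hG0)
  have havC : ∀ k : ℕ, ⨍ y in Metric.closedBall θ (2 ^ k * η), G y ≤ C := fun k => by
    have h1 : ∫ y in Metric.closedBall θ (2 ^ k * η), G y
        ≤ ∫ y in Metric.closedBall θ (2 ^ k * η), C :=
      setIntegral_mono (hint k) (integrableOn_const measure_closedBall_lt_top.ne) hGC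
    rw [setIntegral_const, hvol, smul_eq_mul] at h1
    rw [hav, inv_mul_le_iff₀ (by positivity)]
    exact h1
  have hC0 : 0 ≤ C := (hG0 0).trans (hGC 0)
  have hsum : Summable fun k : ℕ =>
      80 * (1 / 2 : ℝ) ^ k * ⨍ y in Metric.closedBall θ (2 ^ k * η), G y := by
    refine Summable.of_nonneg_of_le (fun k => mul_nonneg (by positivity) (hav0 k))
      (fun k => mul_le_mul_of_nonneg_left (havC k) (by positivity))
      ((summable_geometric_two.mul_left 80).mul_right C)
  have hnn : ∀ τ, 0 ≤ pk (r * circleMap 0 1 θ) τ * G τ := fun τ =>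
    mul_nonneg (pk_nonneg hw τ) (hG0 τ)
  have hint2 : IntegrableOn (fun τ => pk (r * circleMap 0 1 θ) τ * G τ)
      (Ioc (θ - Real.pi) (θ + Real.pi)) := by
    refine Measure.integrableOn_of_bounded (M := 1 / (1 - ‖(r : ℂ) * circleMap 0 1 θ‖) ^ 2 * C)
      measure_Ioc_lt_top.ne ((measurable_pk _).mul hG).aestronglyMeasurable
      (Eventually.of_forall fun x => ?_)
    rw [Real.norm_of_nonneg (hnn x)]
    exact mul_le_mul (pk_le hw le_rfl x) (hGC x) (hG0 x) (by positivity)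
  -- In `ENNReal` the sum and the integral can be exchanged freely.
  rw [← ENNReal.ofReal_le_ofReal_iff (tsum_nonneg fun k => mul_nonneg (by positivity) (hav0 k)),
    ENNReal.ofReal_tsum_of_nonneg (fun k => mul_nonneg (by positivity) (hav0 k)) hsum,
    ofReal_integral_eq_lintegral_ofReal hint2 (Eventually.of_forall hnn)]
  calc ∫⁻ τ in Ioc (θ - Real.pi) (θ + Real.pi),
        ENNReal.ofReal (pk (r * circleMap 0 1 θ) τ * G τ)
      ≤ ∫⁻ τ in Ioc (θ - Real.pi) (θ + Real.pi), ∑' k : ℕ, ENNReal.ofReal (40 / 4 ^ k / η) *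
        (Metric.closedBall θ (2 ^ k * η)).indicator (fun y => ENNReal.ofReal (G y)) τ := by
        refine setLIntegral_mono' measurableSet_Ioc fun τ hτ => ?_
        obtain ⟨j, hj1, hj2⟩ := poisson_bound_dyadic hη0 (τ - θ)
        -- The single term of index `j` already dominates the kernel at `τ`. Balls of length `2 * 2
        -- ^ k * η` turn `40 / 4 ^ k / η` into `80 / 2 ^ k`.
        refine le_trans ?_ (ENNReal.le_tsum j)
        have hmem : τ ∈ Metric.closedBall θ (2 ^ j * η) := by
          rwa [Metric.mem_closedBall, Real.dist_eq]
        rw [indicator_of_mem hmem, ← ENNReal.ofReal_mul (by positivity)]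
        refine ENNReal.ofReal_le_ofReal (mul_le_mul_of_nonneg_right ?_ (hG0 τ))
        refine (pk_le_near hr hr1 θ (abs_le.2 ⟨?_, ?_⟩)).trans hj2
        · linarith [hτ.1]
        · linarith [hτ.2]
    _ ≤ ∫⁻ τ, ∑' k : ℕ, ENNReal.ofReal (40 / 4 ^ k / η) *
        (Metric.closedBall θ (2 ^ k * η)).indicator (fun y => ENNReal.ofReal (G y)) τ :=
        setLIntegral_le_lintegral _ _
    _ = ∑' k : ℕ, ENNReal.ofReal
        (80 * (1 / 2) ^ k * ⨍ y in Metric.closedBall θ (2 ^ k * η), G y) := by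
        have hm : Measurable fun y => ENNReal.ofReal (G y) := hG.ennreal_ofReal
        rw [lintegral_tsum fun k =>
          ((hm.indicator measurableSet_closedBall).const_mul _).aemeasurable]
        refine tsum_congr fun k => ?_
        rw [lintegral_const_mul _ (hm.indicator measurableSet_closedBall),
          lintegral_indicator measurableSet_closedBall,
          ← ofReal_integral_eq_lintegral_ofReal (hint k) (Eventually.of_forall hG0),
          ← ENNReal.ofReal_mul (by positivity), hav]
        congr 1
        have h4 : (4 : ℝ) ^ k = 2 ^ k * 2 ^ k := by rw [← mul_pow]; norm_num
        rw [h4, one_div, inv_pow]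
        field_simp
        ring

theorem periodic_pk (w : ℂ) : Function.Periodic (pk w) (2 * Real.pi) := fun θ => by
  rw [pk, periodic_circleMap 0 1 θ, pk]

theorem integral_angMeas_eq_of_periodic {F : ℝ → ℝ} (hF : Function.Periodic F (2 * Real.pi))
    (θ : ℝ) : ∫ τ, F τ ∂angMeas
      = (2 * Real.pi)⁻¹ * ∫ τ in Ioc (θ - Real.pi) (θ + Real.pi), F τ := by
  rw [integral_angMeas]
  have h := hF.intervalIntegral_add_eq 0 (θ - Real.pi)
  rw [zero_add, show θ - Real.pi + 2 * Real.pi = θ + Real.pi by ring] at h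
  rw [h, intervalIntegral.integral_of_le (by linarith [Real.pi_pos])]

/-- Fatou's theorem: the Poisson integral of a bounded function has radial limits equal to that
function almost everywhere. -/
theorem ae_tendsto_poisson {g : ℝ → ℝ} (hg : Measurable g) {M : ℝ} (hM : ∀ x, |g x| ≤ M)
    (hper : Function.Periodic g (2 * Real.pi)) :
    ∀ᵐ θ : ℝ, Tendsto (fun r : ℝ => ∫ τ, pk (r * circleMap 0 1 θ) τ * g τ ∂angMeas)
      (𝓝[<] 1) (𝓝 (g θ)) := by
  have hloc : LocallyIntegrable g := by
    intro x
    exact ⟨Metric.closedBall x 1, Metric.closedBall_mem_nhds x one_pos,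
      Measure.integrableOn_of_bounded (M := M) measure_closedBall_lt_top.ne
        hg.aestronglyMeasurable (Eventually.of_forall hM)⟩
  -- The good angles are the Lebesgue points of `g`: there each dyadic average tends to `0`, and the
  -- geometric weights allow the limit under the sum.
  filter_upwards [IsUnifLocDoublingMeasure.ae_tendsto_average_norm_sub (μ := volume) hloc 1]
    with θ hθ
  have hav : ∀ k : ℕ, Tendsto
      (fun r : ℝ => ⨍ y in Metric.closedBall θ (2 ^ k * (1 - r)), |g y - g θ|) (𝓝[<] 1) (𝓝 0) := by
    intro k
    refine hθ (fun _ => θ) (fun r => 2 ^ k * (1 - r)) ?_ ?_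
    · refine tendsto_nhdsWithin_iff.2 ⟨?_, ?_⟩
      · have : Continuous fun r : ℝ => (2 : ℝ) ^ k * (1 - r) := by fun_prop
        exact (this.tendsto' 1 0 (by simp)).mono_left nhdsWithin_le_nhds
      · filter_upwards [self_mem_nhdsWithin] with r hr
        have : 0 < 1 - r := sub_pos.2 hr
        exact mem_Ioi.2 (by positivity)
    · filter_upwards [self_mem_nhdsWithin] with r hr
      have : 0 < 1 - r := sub_pos.2 hr
      exact Metric.mem_closedBall_self (by positivity)
  have hGm : Measurable fun y => |g y - g θ| := by fun_prop
  have hGC : ∀ y, |g y - g θ| ≤ 2 * M := fun y => by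
    have := abs_sub (g y) (g θ)
    linarith [hM y, hM θ]
  have htsum : Tendsto (fun r : ℝ => ∑' k : ℕ, 80 * (1 / 2 : ℝ) ^ k *
      ⨍ y in Metric.closedBall θ (2 ^ k * (1 - r)), |g y - g θ|) (𝓝[<] 1) (𝓝 0) := by
    have h0 : (0 : ℝ) = ∑' k : ℕ, 80 * (1 / 2 : ℝ) ^ k * 0 := by simp
    rw [h0]
    refine tendsto_tsum_of_dominated_convergence
      (bound := fun k : ℕ => 80 * (1 / 2 : ℝ) ^ k * (2 * M)) ?_ ?_ ?_
    · exact (summable_geometric_two.mul_left 80).mul_right _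
    · exact fun k => (hav k).const_mul _
    · refine Eventually.of_forall fun r k => ?_
      rw [norm_mul, Real.norm_of_nonneg (by positivity : (0 : ℝ) ≤ 80 * (1 / 2) ^ k)]
      refine mul_le_mul_of_nonneg_left ?_ (by positivity)
      rw [setAverage_eq, smul_eq_mul, norm_mul]
      have h1 : ‖∫ y in Metric.closedBall θ (2 ^ k * (1 - r)), |g y - g θ|‖
          ≤ 2 * M * volume.real (Metric.closedBall θ (2 ^ k * (1 - r))) :=
        norm_setIntegral_le_of_norm_le_const measure_closedBall_lt_top
          fun y _ => by simpa using hGC y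
      have hM0 : 0 ≤ 2 * M := (abs_nonneg _).trans (hGC θ)
      rw [Real.norm_of_nonneg (by positivity)]
      -- The bound is needed for every real `r`; for `r ≥ 1` the ball is null and the average is `0`
      -- by convention.
      rcases eq_or_lt_of_le
        (measureReal_nonneg (μ := volume) (s := Metric.closedBall θ (2 ^ k * (1 - r)))) with h | h
      · rw [← h]; simpa using hM0
      · rw [inv_mul_le_iff₀ h]; linarith
  have hlim := htsum.const_mul (2 * Real.pi)⁻¹
  rw [mul_zero] at hlim
  rw [tendsto_iff_norm_sub_tendsto_zero]
  refine squeeze_zero' (Eventually.of_forall fun _ => norm_nonneg _) ?_ hlim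
  have hnear : ∀ᶠ r in 𝓝[<] (1 : ℝ), 1 / 2 ≤ r :=
    nhdsWithin_le_nhds (Ici_mem_nhds (by norm_num))
  filter_upwards [hnear, self_mem_nhdsWithin] with r hr hr1
  have hw : ‖(r : ℂ) * circleMap 0 1 θ‖ < 1 := by
    simpa [abs_of_nonneg (by linarith : (0 : ℝ) ≤ r)] using hr1
  have h1 : ∫ τ, pk (r * circleMap 0 1 θ) τ * g τ ∂angMeas - g θ
      = ∫ τ, pk (r * circleMap 0 1 θ) τ * (g τ - g θ) ∂angMeas := by
    simp only [mul_sub]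
    rw [integral_sub (integrable_pk_mul hw hg hM)
      (integrable_pk_mul hw measurable_const fun _ => le_rfl), integral_mul_const, integral_pk hw,
      one_mul]
  rw [h1]
  refine (norm_integral_le_integral_norm _).trans ?_
  have h2 : ∀ τ, ‖pk (r * circleMap 0 1 θ) τ * (g τ - g θ)‖
      = pk (r * circleMap 0 1 θ) τ * |g τ - g θ| := fun τ => by
    rw [norm_mul, Real.norm_of_nonneg (pk_nonneg hw τ), Real.norm_eq_abs]
  simp only [h2]
  rw [integral_angMeas_eq_of_periodic (F := fun τ => pk (r * circleMap 0 1 θ) τ * |g τ - g θ|)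
    (fun τ => by dsimp only; rw [periodic_pk, hper]) θ]
  exact mul_le_mul_of_nonneg_left
    (integral_pk_mul_le_tsum hGm (fun _ => abs_nonneg _) hGC hr hr1 θ) (by positivity)

/-! ### Boundary data and their Poisson integral -/

section

/-- Measurable, nonnegative, convex boundary data, uniformly bounded on bounded sets. -/
structure IsBoundaryData {n : ℕ} (φ : bdry → Cn n → ℝ) : Prop where
  nonneg : ∀ s z, 0 ≤ φ s z
  meas : Measurable (Function.uncurry φ)
  conv : ∀ s, ConvexOn ℝ univ (φ s)
  bound : ∀ R : ℝ, ∃ M : ℝ, ∀ s z, ‖z‖ ≤ R → φ s z ≤ M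

/-- The Poisson integral of the boundary data, in the disc variable. -/
def poissonInt {n : ℕ} (φ : bdry → Cn n → ℝ) (x : ℂ × Cn n) : ℝ :=
  ∫ θ, pk x.1 θ * φ (bdryPt θ) x.2 ∂angMeas

theorem continuous_bdryPt : Continuous bdryPt :=
  (continuous_circleMap 0 1).subtype_mk _

theorem periodic_bdryPt : Function.Periodic bdryPt (2 * Real.pi) := fun θ =>
  Subtype.ext (periodic_circleMap 0 1 θ)

variable {n : ℕ} {φ : bdry → Cn n → ℝ}

namespace IsBoundaryData

theorem measurable_angle (hφ : IsBoundaryData φ) (z : Cn n) :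
    Measurable fun θ => φ (bdryPt θ) z :=
  hφ.meas.comp (continuous_bdryPt.measurable.prodMk measurable_const)

/-- A convex function bounded on the ball of radius `2R` is Lipschitz on that of radius `R`, with a
constant depending only on the bound; hence the uniformity in `s`. -/
theorem exists_lipschitz (hφ : IsBoundaryData φ) (R : ℝ) : ∃ L : ℝ, 0 ≤ L ∧ ∀ s w w',
    ‖w‖ < R → ‖w'‖ < R → |φ s w - φ s w'| ≤ L * ‖w - w'‖ := by
  rcases le_or_gt R 0 with hR | hR
  · exact ⟨0, le_rfl, fun s w w' hw => absurd (hw.trans_le hR) (norm_nonneg w).not_gt⟩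
  obtain ⟨M, hM⟩ := hφ.bound (2 * R)
  refine ⟨(2 * M / R).toNNReal, NNReal.coe_nonneg _, fun s w w' hw hw' => ?_⟩
  have h := ConvexOn.lipschitzOnWith_of_abs_le (f := φ s) (x₀ := 0) (r := 2 * R) (ε := R) (M := M)
    ((hφ.conv s).subset (subset_univ _) (convex_ball _ _)) hR (fun a ha => by
      rw [abs_of_nonneg (hφ.nonneg s a)]
      exact hM s a (by simpa using ha.le))
  have h2 := h.dist_le_mul w (by simp; linarith) w' (by simp; linarith)
  rwa [Real.dist_eq, dist_eq_norm] at h2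

theorem continuous (hφ : IsBoundaryData φ) (s : bdry) : Continuous (φ s) := by
  refine continuous_iff_continuousAt.2 fun z => ?_
  obtain ⟨L, hL, h⟩ := hφ.exists_lipschitz (‖z‖ + 1)
  have hlip : LipschitzOnWith L.toNNReal (φ s) (Metric.ball 0 (‖z‖ + 1)) := by
    refine LipschitzOnWith.of_dist_le_mul fun w hw w' hw' => ?_
    rw [Real.dist_eq, dist_eq_norm, Real.coe_toNNReal _ hL]
    exact h s w w' (by simpa using hw) (by simpa using hw')
  exact hlip.continuousOn.continuousAt (Metric.isOpen_ball.mem_nhds (by simp))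

theorem integrable_pk_mul (hφ : IsBoundaryData φ) {t : ℂ} (ht : ‖t‖ < 1) (z : Cn n) :
    Integrable (fun θ => pk t θ * φ (bdryPt θ) z) angMeas := by
  obtain ⟨M, hM⟩ := hφ.bound ‖z‖
  exact PshInterp.integrable_pk_mul ht (hφ.measurable_angle z) (C := M) fun θ => by
    rw [abs_of_nonneg (hφ.nonneg _ _)]; exact hM _ _ le_rfl

theorem poissonInt_nonneg (hφ : IsBoundaryData φ) {t : ℂ} (ht : ‖t‖ < 1) (z : Cn n) :
    0 ≤ poissonInt φ (t, z) :=
  integral_nonneg fun θ => mul_nonneg (pk_nonneg ht θ) (hφ.nonneg _ _)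

theorem poissonInt_le (hφ : IsBoundaryData φ) {t : ℂ} (ht : ‖t‖ < 1) {z : Cn n} {B : ℝ}
    (hB : ∀ s, φ s z ≤ B) : poissonInt φ (t, z) ≤ B := by
  calc poissonInt φ (t, z) ≤ ∫ θ, pk t θ * B ∂angMeas :=
        integral_mono (hφ.integrable_pk_mul ht z)
          (integrable_angMeas_of_continuous ((continuous_pk ht).mul continuous_const))
          fun θ => mul_le_mul_of_nonneg_left (hB _) (pk_nonneg ht θ)
    _ = B := by rw [integral_mul_const, integral_pk ht, one_mul]

theorem continuousAt_poissonInt (hφ : IsBoundaryData φ) {x : ℂ × Cn n} (hx : ‖x.1‖ < 1) :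
    ContinuousAt (poissonInt φ) x := by
  obtain ⟨ρ, hρ1, hρ2⟩ := exists_between hx
  obtain ⟨M, hM⟩ := hφ.bound (‖x.2‖ + 1)
  have hM0 : 0 ≤ M := (hφ.nonneg ⟨1, by simp⟩ x.2).trans (hM _ _ (by linarith))
  have h1 : ∀ᶠ y : ℂ × Cn n in 𝓝 x, ‖y.1‖ < ρ :=
    (continuous_fst.norm.tendsto x).eventually_lt_const hρ1
  have h2 : ∀ᶠ y : ℂ × Cn n in 𝓝 x, ‖y.2‖ < ‖x.2‖ + 1 :=
    (continuous_snd.norm.tendsto x).eventually_lt_const (by linarith)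
  refine continuousAt_of_dominated (bound := fun _ => 1 / (1 - ρ) ^ 2 * M)
    (Eventually.of_forall fun y =>
      ((measurable_pk _).mul (hφ.measurable_angle _)).aestronglyMeasurable) ?_
    (integrable_const _) (Eventually.of_forall fun θ => ?_)
  · filter_upwards [h1, h2] with y hy1 hy2
    refine Eventually.of_forall fun θ => ?_
    rw [norm_mul, Real.norm_of_nonneg (pk_nonneg (hy1.trans hρ2) θ),
      Real.norm_of_nonneg (hφ.nonneg _ _)]
    exact mul_le_mul (pk_le hρ2 hy1.le θ) (hM _ _ hy2.le) (hφ.nonneg _ _) (by positivity)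
  · have h3 : ContinuousAt (fun y : ℂ × Cn n => pk y.1 θ) x := by
      have h4 := continuousOn_pk.continuousAt (x := (x.1, θ))
        ((Metric.isOpen_ball.prod isOpen_univ).mem_nhds ⟨mem_ball_zero_iff.2 hx, mem_univ _⟩)
      exact ContinuousAt.comp (f := fun y : ℂ × Cn n => (y.1, θ)) h4 (by fun_prop)
    exact h3.mul ((hφ.continuous (bdryPt θ)).comp continuous_snd).continuousAt

theorem abs_poissonInt_sub_le (hφ : IsBoundaryData φ) {t : ℂ} (ht : ‖t‖ < 1) {w w' : Cn n} {B : ℝ}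
    (hB : ∀ s, |φ s w - φ s w'| ≤ B) : |poissonInt φ (t, w) - poissonInt φ (t, w')| ≤ B := by
  have hd : ∀ v v' : Cn n, (∀ s, |φ s v - φ s v'| ≤ B) →
      poissonInt φ (t, v) ≤ poissonInt φ (t, v') + B := by
    intro v v' h
    calc poissonInt φ (t, v) ≤ ∫ θ, (pk t θ * φ (bdryPt θ) v' + pk t θ * B) ∂angMeas := by
          refine integral_mono (hφ.integrable_pk_mul ht v) ((hφ.integrable_pk_mul ht v').add
            (integrable_angMeas_of_continuous ((continuous_pk ht).mul continuous_const)))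
            fun θ => ?_
          rw [← mul_add]
          refine mul_le_mul_of_nonneg_left ?_ (pk_nonneg ht θ)
          linarith [(abs_le.1 (h (bdryPt θ))).2]
      _ = poissonInt φ (t, v') + B := by
          rw [integral_add (hφ.integrable_pk_mul ht v')
            (integrable_angMeas_of_continuous (by have := continuous_pk ht; fun_prop)),
            integral_mul_const, integral_pk ht, one_mul]
          rfl
  have h1 := hd w w' hB
  have h2 := hd w' w fun s => by rw [abs_sub_comm]; exact hB s
  exact abs_le.2 ⟨by linarith, by linarith⟩

theorem norm_mul_bdryPt {r : ℝ} (hr0 : 0 ≤ r) (hr : r < 1) (θ : ℝ) :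
    ‖(r : ℂ) * (bdryPt θ : ℂ)‖ < 1 := by
  have : ‖(bdryPt θ : ℂ)‖ = 1 := by simp [bdryPt]
  rw [norm_mul, this, mul_one, Complex.norm_real, Real.norm_of_nonneg hr0]
  exact hr

theorem eventually_Ioo_zero_one : ∀ᶠ r in 𝓝[<] (1 : ℝ), 0 < r ∧ r < 1 :=
  mem_of_superset (Ioo_mem_nhdsLT zero_lt_one) fun _ h => h

/-- The Poisson integral of the boundary data attains the boundary data almost everywhere. -/
theorem ae_tendsto_poissonInt (hφ : IsBoundaryData φ) : ∀ᵐ θ : ℝ, ∀ z : Cn n,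
    Tendsto (fun q : ℝ × Cn n => poissonInt φ ((q.1 : ℂ) * (bdryPt θ : ℂ), q.2))
      (𝓝[<] (1 : ℝ) ×ˢ 𝓝 z) (𝓝 (φ (bdryPt θ) z)) := by
  -- The null set of Fatou's theorem depends on `z`, so only countably many `z` are allowed here.
  have h1 : ∀ᵐ θ : ℝ, ∀ k : ℕ, Tendsto (fun r : ℝ =>
      poissonInt φ ((r : ℂ) * (bdryPt θ : ℂ), TopologicalSpace.denseSeq (Cn n) k)) (𝓝[<] 1)
      (𝓝 (φ (bdryPt θ) (TopologicalSpace.denseSeq (Cn n) k))) := by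
    refine ae_all_iff.2 fun k => ?_
    obtain ⟨M, hM⟩ := hφ.bound ‖TopologicalSpace.denseSeq (Cn n) k‖
    exact ae_tendsto_poisson (hφ.measurable_angle _) (M := M)
      (fun θ => by rw [abs_of_nonneg (hφ.nonneg _ _)]; exact hM _ _ le_rfl)
      (fun θ => by rw [periodic_bdryPt])
  filter_upwards [h1] with θ hθ z
  obtain ⟨L, hL, hlip⟩ := hφ.exists_lipschitz (‖z‖ + 1)
  refine Metric.tendsto_nhds.2 fun ε hε => ?_
  obtain ⟨δ, hδ0, hδ1, hδ⟩ : ∃ δ : ℝ, 0 < δ ∧ δ ≤ 1 ∧ L * δ ≤ ε / 8 := by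
    refine ⟨min 1 (ε / 8 / (L + 1)), by positivity, min_le_left _ _, ?_⟩
    calc L * min 1 (ε / 8 / (L + 1)) ≤ (L + 1) * (ε / 8 / (L + 1)) :=
          mul_le_mul (by linarith) (min_le_right _ _) (by positivity) (by positivity)
      _ = ε / 8 := by field_simp
  obtain ⟨k, hk⟩ := (TopologicalSpace.denseRange_denseSeq (Cn n)).exists_dist_lt z hδ0
  set d := TopologicalSpace.denseSeq (Cn n) k
  have hnorm : ∀ w : Cn n, dist z w < δ → ‖w‖ < ‖z‖ + 1 := by
    intro w hw
    rw [dist_eq_norm] at hw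
    have := norm_sub_norm_le w z
    rw [norm_sub_rev] at this
    linarith
  have hwd : ∀ w : Cn n, dist z w < δ → ∀ s, |φ s w - φ s d| ≤ ε / 4 := by
    intro w hw s
    refine (hlip s w d (hnorm w hw) (hnorm d hk)).trans ?_
    have h2 : ‖w - d‖ ≤ 2 * δ := by
      rw [← dist_eq_norm]
      have := dist_triangle_left w d z
      linarith
    nlinarith
  have hz := hwd z (by simpa using hδ0) (bdryPt θ)
  have hr := Metric.tendsto_nhds.1 (hθ k) (ε / 4) (by positivity)
  have hw : ∀ᶠ w in 𝓝 z, dist z w < δ := by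
    filter_upwards [Metric.ball_mem_nhds z hδ0] with w hw
    rwa [dist_comm]
  filter_upwards [(hr.and eventually_Ioo_zero_one).prod_mk hw] with q hq
  obtain ⟨⟨hq1, hq2⟩, hq3⟩ := hq
  have h5 := hφ.abs_poissonInt_sub_le (norm_mul_bdryPt hq2.1.le hq2.2 θ) (hwd q.2 hq3)
  rw [Real.dist_eq] at hq1 ⊢
  rw [abs_lt] at hq1 ⊢
  rw [abs_le] at h5 hz
  constructor <;> linarith

theorem boundaryLE_of_le_poissonInt (hφ : IsBoundaryData φ) {ψ : ℂ × Cn n → ℝ}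
    (h : ∀ t z, ‖t‖ < 1 → ψ (t, z) ≤ poissonInt φ (t, z)) : BoundaryLE ψ φ := by
  filter_upwards [hφ.ae_tendsto_poissonInt] with θ hθ z
  have h1 := (continuous_coe_real_ereal.tendsto _).comp (hθ z)
  have h2 := h1.limsup_eq
  rw [← h2]
  refine limsup_le_limsup ?_
  filter_upwards [(eventually_Ioo_zero_one).prod_inl (𝓝 z)] with q hq
  exact EReal.coe_le_coe_iff.2 (h _ _ (norm_mul_bdryPt hq.1.le hq.2 θ))

theorem tendsto_pk_div {t : ℂ} (ht : ‖t‖ < 1) (θ : ℝ) :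
    Tendsto (fun r : ℝ => pk (t / (r : ℂ)) θ) (𝓝[<] 1) (𝓝 (pk t θ)) := by
  have h4 : ContinuousAt (fun x : ℂ × ℝ => pk x.1 x.2) (t, θ) :=
    continuousOn_pk.continuousAt
      ((Metric.isOpen_ball.prod isOpen_univ).mem_nhds ⟨mem_ball_zero_iff.2 ht, mem_univ _⟩)
  have h6 : ContinuousAt (fun r : ℝ => t / (r : ℂ)) 1 :=
    continuousAt_const.div Complex.continuous_ofReal.continuousAt (by simp)
  have h5 : Tendsto (fun r : ℝ => (t / (r : ℂ), θ)) (𝓝[<] 1) (𝓝 (t, θ)) := by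
    refine Tendsto.prodMk_nhds ?_ tendsto_const_nhds
    have h7 : Tendsto (fun r : ℝ => t / (r : ℂ)) (𝓝[<] 1) (𝓝 (t / ((1 : ℝ) : ℂ))) :=
      h6.tendsto.mono_left nhdsWithin_le_nhds
    rwa [Complex.ofReal_one, div_one] at h7
  have h8 := h4.tendsto.comp h5
  simpa only [Function.comp_def] using h8

/-- Every competitor lies below the Poisson integral of the boundary data. -/
theorem le_poissonInt (hφ : IsBoundaryData φ) {ψ : ℂ × Cn n → ℝ} (hψ : IsCompetitor φ ψ)
    {t : ℂ} (ht : ‖t‖ < 1) (z : Cn n) : ψ (t, z) ≤ poissonInt φ (t, z) := by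
  obtain ⟨M, hM⟩ := hφ.bound ‖z‖
  have hM' : ∀ s, φ s z ≤ M := fun s => hM s z le_rfl
  have hM0 : 0 ≤ M := (hφ.nonneg ⟨1, by simp⟩ z).trans (hM' _)
  have hψM : ∀ τ : ℂ, ‖τ‖ < 1 → ψ (τ, z) ≤ M := by
    intro τ hτ
    have h1 := hψ.le_sup τ (mem_ball_zero_iff.2 hτ) z
    have h2 : ⨆ s : bdry, ((φ s z : ℝ) : EReal) ≤ (M : EReal) :=
      iSup_le fun s => EReal.coe_le_coe_iff.2 (hM' s)
    exact EReal.coe_le_coe_iff.1 (h1.trans h2)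
  have husc := upperSemicontinuousOn_coe_ereal.1 hψ.psh.usc
  obtain ⟨ρ, hρ1, hρ2⟩ := exists_between ht
  have hρ0 : 0 < ρ := (norm_nonneg t).trans_lt hρ1
  -- `ψ` need not be bounded below. Truncation at `0` costs nothing in the limit, because `φ ≥ 0`.
  let v : ℝ → ℂ → ℝ := fun r ζ => max (ψ (r * ζ, z)) 0
  have hmul : ∀ {r : ℝ}, 0 < r → r < 1 → ∀ {ζ : ℂ}, ‖ζ‖ ≤ 1 → ‖(r : ℂ) * ζ‖ < 1 := by
    intro r hr0 hr1 ζ hζ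
    rw [norm_mul, Complex.norm_real, Real.norm_of_nonneg hr0.le]
    nlinarith [norm_nonneg ζ]
  have hvusc : ∀ r : ℝ, 0 < r → r < 1 →
      UpperSemicontinuousOn (v r) (Metric.sphere (0 : ℂ) 1) := by
    intro r hr0 hr1
    refine UpperSemicontinuousOn.sup ?_ continuousOn_const.upperSemicontinuousOn
    refine husc.comp (g := fun ζ : ℂ => ((r : ℂ) * ζ, z)) (by fun_prop) fun ζ hζ => ?_
    exact ⟨mem_ball_zero_iff.2 (hmul hr0 hr1 (mem_sphere_zero_iff_norm.1 hζ).le), mem_univ _⟩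
  have hvM : ∀ r : ℝ, 0 < r → r < 1 → ∀ ζ ∈ Metric.sphere (0 : ℂ) 1, |v r ζ| ≤ M := by
    intro r hr0 hr1 ζ hζ
    rw [abs_of_nonneg (le_max_right _ _)]
    exact max_le (hψM _ (hmul hr0 hr1 (mem_sphere_zero_iff_norm.1 hζ).le)) hM0
  have hnear : ∀ᶠ r in 𝓝[<] (1 : ℝ), 0 < r ∧ r < 1 ∧ ‖t‖ / r < ρ := by
    have h1 : ContinuousAt (fun r : ℝ => ‖t‖ / r) 1 :=
      continuousAt_const.div continuousAt_id one_ne_zero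
    have h2 : ∀ᶠ r in 𝓝[<] (1 : ℝ), ‖t‖ / r < ρ :=
      nhdsWithin_le_nhds (h1.tendsto.eventually_lt_const (by simpa using hρ1))
    filter_upwards [eventually_Ioo_zero_one, h2] with r hr h3
    exact ⟨hr.1, hr.2, h3⟩
  have hnorm : ∀ r : ℝ, 0 < r → ‖t / (r : ℂ)‖ = ‖t‖ / r := by
    intro r hr
    rw [norm_div, Complex.norm_real, Real.norm_of_nonneg hr.le]
  -- The boundary condition bounds only a limsup. Taking the maximum with `φ` turns it into a
  -- genuine limit, as dominated convergence requires.
  have hle : ∀ᶠ r : ℝ in 𝓝[<] (1 : ℝ), ψ (t, z) ≤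
      ∫ θ, pk (t / (r : ℂ)) θ * max (v r (circleMap 0 1 θ)) (φ (bdryPt θ) z) ∂angMeas := by
    filter_upwards [hnear] with r hr
    obtain ⟨hr0, hr1, hr2⟩ := hr
    have hw : ‖t / (r : ℂ)‖ < 1 := by rw [hnorm r hr0]; exact hr2.trans hρ2
    have h1 : ψ (t, z) ≤ ∫ θ, pk (t / r) θ * v r (circleMap 0 1 θ) ∂angMeas := by
      refine le_poisson_of_forall_polynomial (hvM r hr0 hr1) (hvusc r hr0 hr1) hw fun q hq => ?_
      have h2 := hψ.psh.le_re_polynomial (a := 0) (b := r) (f := fun _ => z) (ζ₀ := t / r)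
        (fun ζ hζ => by
          rw [zero_add, mul_comm]
          exact mem_ball_zero_iff.2 (hmul hr0 hr1 hζ)) diffContOnCl_const q
        (fun ζ hζ => by
          rw [zero_add, mul_comm]
          exact (le_max_left _ _).trans (hq ζ hζ)) hw
      rwa [zero_add, div_mul_cancel₀ _ (by exact_mod_cast hr0.ne')] at h2
    refine h1.trans (integral_mono ?_ ?_ fun θ =>
      mul_le_mul_of_nonneg_left (le_max_left _ _) (pk_nonneg hw θ))
    · exact PshInterp.integrable_pk_mul hw (measurable_comp_circleMap (hvusc r hr0 hr1))
        fun θ => hvM r hr0 hr1 _ (circleMap_mem_unit θ)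
    · refine PshInterp.integrable_pk_mul hw (C := M) ((measurable_comp_circleMap
        (hvusc r hr0 hr1)).max (hφ.measurable_angle z)) fun θ => ?_
      rw [abs_of_nonneg (le_max_of_le_right (hφ.nonneg _ _))]
      exact max_le ((le_abs_self _).trans (hvM r hr0 hr1 _ (circleMap_mem_unit θ))) (hM' _)
  refine ge_of_tendsto ?_ hle
  refine tendsto_integral_filter_of_dominated_convergence (fun _ => 1 / (1 - ρ) ^ 2 * M) ?_ ?_
    (integrable_const _) ?_
  · filter_upwards [hnear] with r hr
    exact ((measurable_pk _).mul ((measurable_comp_circleMap (hvusc r hr.1 hr.2.1)).max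
      (hφ.measurable_angle z))).aestronglyMeasurable
  · filter_upwards [hnear] with r hr
    obtain ⟨hr0, hr1, hr2⟩ := hr
    rw [← hnorm r hr0] at hr2
    refine Eventually.of_forall fun θ => ?_
    rw [norm_mul, Real.norm_of_nonneg (pk_nonneg (hr2.trans hρ2) θ),
      Real.norm_of_nonneg (le_max_of_le_right (hφ.nonneg _ _))]
    refine mul_le_mul (pk_le hρ2 hr2.le θ) ?_ (le_max_of_le_right (hφ.nonneg _ _)) (by positivity)
    exact max_le ((le_abs_self _).trans (hvM r hr0 hr1 _ (circleMap_mem_unit θ))) (hM' _)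
  · filter_upwards [ae_angMeas hψ.bdry_le] with θ hθ
    refine (tendsto_pk_div ht θ).mul (tendsto_order.2 ⟨fun c hc => Eventually.of_forall fun r =>
      hc.trans_le (le_max_right _ _), fun c hc => ?_⟩)
    have h1 := eventually_lt_of_limsup_lt ((hθ z).trans_lt (EReal.coe_lt_coe_iff.2 hc))
    have h2 : Tendsto (fun r : ℝ => (r, z)) (𝓝[<] 1) (𝓝[<] (1 : ℝ) ×ˢ 𝓝 z) :=
      tendsto_id.prodMk tendsto_const_nhds
    filter_upwards [h2.eventually h1] with r hr
    refine max_lt (max_lt (EReal.coe_lt_coe_iff.1 hr) ((hφ.nonneg _ _).trans_lt hc)) hc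

end IsBoundaryData

end

/-! ### The envelope is its own regularization -/

section

variable {n : ℕ} {φ : bdry → Cn n → ℝ}

/-- The domain `𝔻 × ℂⁿ`. -/
abbrev cyl (n : ℕ) : Set (ℂ × Cn n) := disc ×ˢ univ

theorem isOpen_cyl : IsOpen (cyl n) := Metric.isOpen_ball.prod isOpen_univ

theorem mem_cyl {x : ℂ × Cn n} : x ∈ cyl n ↔ ‖x.1‖ < 1 := by
  simp [cyl, disc]

theorem upperSemicontinuous_comp_circle {w : ℂ × Cn n → ℝ} (hw : UpperSemicontinuousOn w (cyl n))
    {a b : ℂ × Cn n} (hab : ∀ ζ : ℂ, ‖ζ‖ ≤ 1 → a + ζ • b ∈ cyl n) :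
    UpperSemicontinuous fun θ => w (a + circleMap 0 1 θ • b) := by
  rw [← upperSemicontinuousOn_univ_iff]
  have hc : Continuous fun θ => a + circleMap 0 1 θ • b :=
    continuous_const.add ((continuous_circleMap 0 1).smul continuous_const)
  exact hw.comp hc.continuousOn fun θ _ => hab _ (by simp)

theorem bddAbove_disc {w : ℂ × Cn n → ℝ} (hw : UpperSemicontinuousOn w (cyl n))
    {a b : ℂ × Cn n} (hab : ∀ ζ : ℂ, ‖ζ‖ ≤ 1 → a + ζ • b ∈ cyl n) :
    ∃ B, ∀ ζ : ℂ, ‖ζ‖ ≤ 1 → w (a + ζ • b) ≤ B := by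
  obtain ⟨B, hB⟩ := UpperSemicontinuousOn.bddAbove_of_isCompact
    (f := fun ζ : ℂ => w (a + ζ • b)) (isCompact_closedBall (0 : ℂ) 1)
    (hw.comp (g := fun ζ : ℂ => a + ζ • b) (by fun_prop)
      fun ζ hζ => hab ζ (mem_closedBall_zero_iff.1 hζ))
  exact ⟨B, fun ζ hζ => hB ⟨ζ, mem_closedBall_zero_iff.2 hζ, rfl⟩⟩

theorem isPSH_coe {w : ℂ × Cn n → ℝ} (husc : UpperSemicontinuousOn w (cyl n))
    (h0 : ∀ x ∈ cyl n, 0 ≤ w x)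
    (hsub : ∀ a b : ℂ × Cn n, (∀ ζ : ℂ, ‖ζ‖ ≤ 1 → a + ζ • b ∈ cyl n) →
      w a ≤ ∫ θ, w (a + circleMap 0 1 θ • b) ∂angMeas) :
    IsPSH (cyl n) (fun x => (w x : EReal)) where
  lt_top := fun _ _ => EReal.coe_lt_top _
  usc := upperSemicontinuousOn_coe_ereal.2 husc
  submean := fun a b hab => by
    obtain ⟨B, hB⟩ := bddAbove_disc husc hab
    rw [angularMean_coe (integrable_angMeas_of_bound
      (upperSemicontinuous_comp_circle husc hab).measurable (C := B) fun θ => ?_)]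
    · exact EReal.coe_le_coe_iff.2 (hsub a b hab)
    · rw [abs_of_nonneg (h0 _ (hab _ (by simp)))]
      exact hB _ (by simp)

/-- The upper semicontinuous regularization of the interpolant. -/
def interpStar (φ : bdry → Cn n → ℝ) (x : ℂ × Cn n) : ℝ :=
  limsup (fun y : ℂ × Cn n => interp φ y.1 y.2) (𝓝 x)

namespace IsBoundaryData

/-- `P` has boundary values `φ` and, the kernel having mass one, stays below `sup_s φ`; so both
bounds on a competitor reduce to one inequality. -/
theorem isCompetitor_of_le_poissonInt (hφ : IsBoundaryData φ) {ψ : ℂ × Cn n → ℝ}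
    (hψ : IsPSH (cyl n) (fun x => (ψ x : EReal)))
    (hle : ∀ t z, ‖t‖ < 1 → ψ (t, z) ≤ poissonInt φ (t, z)) : IsCompetitor φ ψ where
  psh := hψ
  le_sup := fun t ht z => by
    refine le_of_forall_gt_imp_ge_of_dense fun c hc => ?_
    obtain ⟨c', hc1, hc2⟩ := EReal.lt_iff_exists_real_btwn.1 hc
    refine le_trans ?_ hc2.le
    rw [mem_ball_zero_iff] at ht
    refine EReal.coe_le_coe_iff.2 ((hle t z ht).trans (hφ.poissonInt_le ht fun s => ?_))
    exact EReal.coe_le_coe_iff.1 ((le_iSup (fun s : bdry => ((φ s z : ℝ) : EReal)) s).trans hc1.le)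
  bdry_le := hφ.boundaryLE_of_le_poissonInt hle

theorem zero_isCompetitor (hφ : IsBoundaryData φ) : IsCompetitor φ (fun _ => 0) :=
  hφ.isCompetitor_of_le_poissonInt
    (isPSH_coe continuousOn_const.upperSemicontinuousOn (fun _ _ => le_rfl) (by simp))
    fun _ z ht => hφ.poissonInt_nonneg ht z

theorem isLUB_interp (hφ : IsBoundaryData φ) {t : ℂ} (ht : ‖t‖ < 1) (z : Cn n) :
    IsLUB (competitorValues φ t z) (interp φ t z) := by
  refine isLUB_csSup ⟨0, _, hφ.zero_isCompetitor, rfl⟩ ⟨poissonInt φ (t, z), ?_⟩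
  rintro _ ⟨ψ, hψ, rfl⟩
  exact hφ.le_poissonInt hψ ht z

theorem le_interp (hφ : IsBoundaryData φ) {ψ : ℂ × Cn n → ℝ} (hψ : IsCompetitor φ ψ) {t : ℂ}
    (ht : ‖t‖ < 1) (z : Cn n) : ψ (t, z) ≤ interp φ t z :=
  (hφ.isLUB_interp ht z).1 ⟨ψ, hψ, rfl⟩

theorem interp_nonneg (hφ : IsBoundaryData φ) {t : ℂ} (ht : ‖t‖ < 1) (z : Cn n) :
    0 ≤ interp φ t z :=
  hφ.le_interp hφ.zero_isCompetitor ht z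

theorem interp_le_poissonInt (hφ : IsBoundaryData φ) {t : ℂ} (ht : ‖t‖ < 1) (z : Cn n) :
    interp φ t z ≤ poissonInt φ (t, z) := by
  refine (hφ.isLUB_interp ht z).2 ?_
  rintro _ ⟨ψ, hψ, rfl⟩
  exact hφ.le_poissonInt hψ ht z

section interpStar

variable {x : ℂ × Cn n}

theorem eventually_interp_lt (hφ : IsBoundaryData φ) (hx : x ∈ cyl n) {c : ℝ}
    (hc : poissonInt φ x < c) : ∀ᶠ y : ℂ × Cn n in 𝓝 x, interp φ y.1 y.2 < c := by
  filter_upwards [(hφ.continuousAt_poissonInt (mem_cyl.1 hx)).tendsto.eventually_lt_const hc,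
    isOpen_cyl.mem_nhds hx] with y hy hy2
  exact (hφ.interp_le_poissonInt (mem_cyl.1 hy2) y.2).trans_lt hy

theorem eventually_interp_nonneg (hφ : IsBoundaryData φ) (hx : x ∈ cyl n) :
    ∀ᶠ y : ℂ × Cn n in 𝓝 x, 0 ≤ interp φ y.1 y.2 := by
  filter_upwards [isOpen_cyl.mem_nhds hx] with y hy
  exact hφ.interp_nonneg (mem_cyl.1 hy) y.2

/-- A real limsup is meaningful only between two bounds: here the Poisson integral above and, in the
next lemma, the zero competitor below. -/
theorem isBoundedUnder_interp (hφ : IsBoundaryData φ) (hx : x ∈ cyl n) :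
    (𝓝 x).IsBoundedUnder (· ≤ ·) fun y : ℂ × Cn n => interp φ y.1 y.2 :=
  ⟨poissonInt φ x + 1, (hφ.eventually_interp_lt hx (lt_add_one _)).mono fun _ h => h.le⟩

theorem isCoboundedUnder_interp (hφ : IsBoundaryData φ) (hx : x ∈ cyl n) :
    (𝓝 x).IsCoboundedUnder (· ≤ ·) fun y : ℂ × Cn n => interp φ y.1 y.2 :=
  IsBoundedUnder.isCoboundedUnder_le ⟨0, hφ.eventually_interp_nonneg hx⟩

theorem interp_le_interpStar (hφ : IsBoundaryData φ) (hx : x ∈ cyl n) :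
    interp φ x.1 x.2 ≤ interpStar φ x := by
  refine le_limsup_of_frequently_le ?_ (hφ.isBoundedUnder_interp hx)
  exact Frequently.filter_mono (f := pure x)
    (by simp) (pure_le_nhds x)

theorem interpStar_le_poissonInt (hφ : IsBoundaryData φ) (hx : x ∈ cyl n) :
    interpStar φ x ≤ poissonInt φ x :=
  le_of_forall_gt_imp_ge_of_dense fun _ hc =>
    limsup_le_of_le (hφ.isCoboundedUnder_interp hx)
      ((hφ.eventually_interp_lt hx hc).mono fun _ h => h.le)

theorem interpStar_nonneg (hφ : IsBoundaryData φ) (hx : x ∈ cyl n) : 0 ≤ interpStar φ x :=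
  (hφ.interp_nonneg (mem_cyl.1 hx) x.2).trans (hφ.interp_le_interpStar hx)

theorem upperSemicontinuousOn_interpStar (hφ : IsBoundaryData φ) :
    UpperSemicontinuousOn (interpStar φ) (cyl n) := by
  intro x hx c hc
  obtain ⟨c', hc1, hc2⟩ := exists_between hc
  have h1 := eventually_lt_of_limsup_lt hc1 (hφ.isBoundedUnder_interp hx)
  refine nhdsWithin_le_nhds ?_
  filter_upwards [h1.eventually_nhds, isOpen_cyl.mem_nhds hx] with y hy hy2
  exact (limsup_le_of_le (hφ.isCoboundedUnder_interp hy2) (hy.mono fun _ h => h.le)).trans_lt hc2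

/-- Some competitor at some `y` near `a` almost reaches the value at `a`. Its sub-mean inequality on
the disc translated to `y` passes to the limit, since circle means of a bounded upper semicontinuous
function are upper semicontinuous in the centre. -/
theorem interpStar_submean (hφ : IsBoundaryData φ) {a b : ℂ × Cn n}
    (hab : ∀ ζ : ℂ, ‖ζ‖ ≤ 1 → a + ζ • b ∈ cyl n) :
    interpStar φ a ≤ ∫ θ, interpStar φ (a + circleMap 0 1 θ • b) ∂angMeas := by
  have hcball := isCompact_closedBall (0 : ℂ) 1
  have husc := hφ.upperSemicontinuousOn_interpStar
  have hacyl : a ∈ cyl n := by simpa using hab 0 (by simp)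
  have hlineCont : Continuous fun y : (ℂ × Cn n) × ℂ => y.1 + y.2 • b := by fun_prop
  obtain ⟨B, hB⟩ := bddAbove_disc husc hab
  have hnear : ∀ᶠ y in 𝓝 a, ∀ ζ ∈ Metric.closedBall (0 : ℂ) 1,
      y + ζ • b ∈ cyl n ∧ interpStar φ (y + ζ • b) < B + 1 := by
    refine hcball.eventually_forall_of_forall_eventually fun ζ hζ => ?_
    have hmem := hab ζ (mem_closedBall_zero_iff.1 hζ)
    have hlt : interpStar φ (a + ζ • b) < B + 1 :=
      (hB ζ (mem_closedBall_zero_iff.1 hζ)).trans_lt (lt_add_one B)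
    have h1 : ∀ᶠ y in 𝓝 (a + ζ • b), interpStar φ y < B + 1 := by
      have := husc _ hmem _ hlt
      rwa [isOpen_cyl.nhdsWithin_eq hmem] at this
    exact (hlineCont.tendsto (a, ζ)).eventually ((isOpen_cyl.eventually_mem hmem).and h1)
  set I : ℝ → ℝ := fun θ => interpStar φ (a + circleMap 0 1 θ • b) with hI
  have hmeas : ∀ {y}, (∀ ζ ∈ Metric.closedBall (0 : ℂ) 1,
      y + ζ • b ∈ cyl n ∧ interpStar φ (y + ζ • b) < B + 1) →
      Measurable fun θ => interpStar φ (y + circleMap 0 1 θ • b) := fun {y} hy =>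
    (upperSemicontinuous_comp_circle husc
      fun ζ hζ => (hy ζ (mem_closedBall_zero_iff.2 hζ)).1).measurable
  have hcirc : ∀ θ : ℝ, circleMap 0 1 θ ∈ Metric.closedBall (0 : ℂ) 1 := fun θ =>
    Metric.sphere_subset_closedBall (circleMap_mem_unit θ)
  have hbd : ∀ {y}, (∀ ζ ∈ Metric.closedBall (0 : ℂ) 1,
      y + ζ • b ∈ cyl n ∧ interpStar φ (y + ζ • b) < B + 1) →
      ∀ θ : ℝ, |interpStar φ (y + circleMap 0 1 θ • b)| ≤ B + 1 := fun {y} hy θ => by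
    have h := hy _ (hcirc θ)
    rw [abs_of_nonneg (hφ.interpStar_nonneg h.1)]
    exact h.2.le
  have ha := hnear.self_of_nhds
  -- As `y → a` the integrand has only a limsup bound; the maximum with `I θ` makes it converge.
  have hlim : Tendsto (fun y => ∫ θ, max (interpStar φ (y + circleMap 0 1 θ • b)) (I θ) ∂angMeas)
      (𝓝 a) (𝓝 (∫ θ, I θ ∂angMeas)) := by
    refine tendsto_integral_filter_of_dominated_convergence (fun _ => B + 1) ?_ ?_
      (integrable_const _) (Eventually.of_forall fun θ => ?_)
    · filter_upwards [hnear] with y hy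
      exact ((hmeas hy).max (hmeas ha)).aestronglyMeasurable
    · filter_upwards [hnear] with y hy
      exact Eventually.of_forall fun θ => abs_max_le_max_abs_abs.trans (max_le (hbd hy θ) (hbd ha θ))
    · refine tendsto_order.2 ⟨fun c hc => Eventually.of_forall fun y =>
        hc.trans_le (le_max_right _ _), fun c hc => ?_⟩
      have hmem := (ha _ (hcirc θ)).1
      have h1 := husc _ hmem c hc
      rw [isOpen_cyl.nhdsWithin_eq hmem] at h1
      have h2 : Continuous fun y : ℂ × Cn n => y + circleMap 0 1 θ • b := by fun_prop
      filter_upwards [(h2.tendsto a).eventually h1] with y hy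
      exact max_lt hy hc
  refine le_of_forall_lt_imp_le_of_dense fun c hc => ?_
  by_contra! hlt
  have hfreq : ∃ᶠ y : ℂ × Cn n in 𝓝 a, c < interp φ y.1 y.2 :=
    frequently_lt_of_lt_limsup (hφ.isCoboundedUnder_interp hacyl) hc
  obtain ⟨y, hcy, hy, hyc⟩ := (hfreq.and_eventually
    (hnear.and (hlim.eventually_lt_const hlt))).exists
  have hycyl : y ∈ cyl n := by simpa using (hy 0 (by simp)).1
  obtain ⟨_, ⟨ψ, hψ, rfl⟩, hcψ⟩ := (lt_isLUB_iff (hφ.isLUB_interp (mem_cyl.1 hycyl) y.2)).1 hcy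
  have hle : ∀ θ, ψ (y + circleMap 0 1 θ • b)
      ≤ max (interpStar φ (y + circleMap 0 1 θ • b)) (I θ) := fun θ => by
    have h := (hy _ (hcirc θ)).1
    exact ((hφ.le_interp hψ (mem_cyl.1 h) _).trans (hφ.interp_le_interpStar h)).trans
      (le_max_left _ _)
  have h1 := (hψ.psh.submean y b fun ζ hζ => (hy ζ (mem_closedBall_zero_iff.2 hζ)).1).trans
    (angularMean_mono fun θ => EReal.coe_le_coe_iff.2 (hle θ))
  rw [angularMean_coe (integrable_angMeas_of_bound ((hmeas hy).max (hmeas ha)) (C := B + 1)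
    fun θ => abs_max_le_max_abs_abs.trans (max_le (hbd hy θ) (hbd ha θ))),
    EReal.coe_le_coe_iff] at h1
  change c < ψ y at hcψ
  linarith

end interpStar

theorem isPSH_interpStar (hφ : IsBoundaryData φ) :
    IsPSH (cyl n) (fun x => (interpStar φ x : EReal)) :=
  isPSH_coe hφ.upperSemicontinuousOn_interpStar (fun _ hx => hφ.interpStar_nonneg hx)
    fun _ _ hab => hφ.interpStar_submean hab

/-- The regularization is plurisubharmonic and below `P`, so it competes in the supremum that it
regularizes. -/
theorem interpStar_eq (hφ : IsBoundaryData φ) {x : ℂ × Cn n} (hx : x ∈ cyl n) :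
    interpStar φ x = interp φ x.1 x.2 :=
  le_antisymm (hφ.le_interp (hφ.isCompetitor_of_le_poissonInt hφ.isPSH_interpStar fun _ _ ht =>
    hφ.interpStar_le_poissonInt (mem_cyl.2 ht)) (mem_cyl.1 hx) x.2)
    (hφ.interp_le_interpStar hx)

end IsBoundaryData

end

/-! ### The logarithm of a homogeneous plurisubharmonic function -/

section

theorem IsPSH.congr {V : Type*} [NormedAddCommGroup V] [NormedSpace ℂ V] {Ω : Set V}
    {u v : V → EReal} (hu : IsPSH Ω u) (huv : EqOn u v Ω) : IsPSH Ω v where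
  lt_top := fun a ha => huv ha ▸ hu.lt_top a ha
  usc := fun x hx c hc => by
    have hc' : u x < c := (huv hx).trans_lt hc
    filter_upwards [hu.usc x hx c hc', self_mem_nhdsWithin] with y hy hy2
    exact (huv hy2).symm.trans_lt hy
  submean := fun a b hab => by
    have h := hu.submean a b hab
    have ha : a ∈ Ω := by simpa using hab 0 (by simp)
    rw [huv ha] at h
    refine h.trans_eq (congrArg angularMean (funext fun θ => huv (hab _ (by simp))))

/-- A lower bound for the means of the truncations from below of `L` is a lower bound for the mean
of `L`. -/
theorem le_angularMean_of_truncations {L : ℝ → EReal} {c : ℝ} {g : ℕ → ℝ → ℝ}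
    (hgm : ∀ k, Measurable (g k)) (hgi : ∀ k, Integrable (g k) angMeas)
    (hpos : ∀ k θ, (L θ).toENNReal = ENNReal.ofReal (g k θ))
    (hneg : ∀ θ, (-L θ).toENNReal ≤ ⨆ k, ENNReal.ofReal (-g k θ))
    (hanti : Antitone g) (hc : ∀ k, c ≤ ∫ θ, g k θ ∂angMeas) :
    (c : EReal) ≤ angularMean L := by
  rw [angularMean_eq]
  set P := ∫⁻ θ, (L θ).toENNReal ∂angMeas with hP
  have hPk : ∀ k, ∫⁻ θ, ENNReal.ofReal (g k θ) ∂angMeas = P := fun k =>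
    lintegral_congr fun θ => (hpos k θ).symm
  have hPtop : P ≠ ⊤ := by
    rw [← hPk 0]; exact (hgi 0).lintegral_lt_top.ne
  -- All truncations share the positive part, of mean `P`, so their negative parts have means at
  -- most `P - c`; monotone convergence then passes this to `L`.
  have hN : ∀ k, ∫⁻ θ, ENNReal.ofReal (-g k θ) ∂angMeas ≤ ENNReal.ofReal (P.toReal - c) := by
    intro k
    have h1 := hc k
    have hfin : ∫⁻ θ, ENNReal.ofReal (-g k θ) ∂angMeas ≠ ⊤ := (hgi k).neg.lintegral_lt_top.ne
    rw [integral_eq_lintegral_pos_part_sub_lintegral_neg_part (hgi k), hPk] at h1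
    rw [← ENNReal.ofReal_toReal hfin]
    exact ENNReal.ofReal_le_ofReal (by linarith)
  have hc0 : 0 ≤ P.toReal - c := by
    have h1 := hc 0
    rw [integral_eq_lintegral_pos_part_sub_lintegral_neg_part (hgi 0), hPk] at h1
    linarith [ENNReal.toReal_nonneg (a := ∫⁻ θ, ENNReal.ofReal (-g 0 θ) ∂angMeas)]
  have hNL : ∫⁻ θ, (-L θ).toENNReal ∂angMeas ≤ ENNReal.ofReal (P.toReal - c) := by
    refine (lintegral_mono hneg).trans ?_
    rw [lintegral_iSup (f := fun k θ => ENNReal.ofReal (-g k θ))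
      (fun k => (hgm k).neg.ennreal_ofReal) fun k l hkl θ =>
      ENNReal.ofReal_le_ofReal (neg_le_neg (hanti hkl θ))]
    exact iSup_le hN
  have h2 : ((c : ℝ) : EReal) = (P : EReal) - ((ENNReal.ofReal (P.toReal - c) : ENNReal) : EReal) := by
    rw [EReal.coe_ennreal_ofReal, max_eq_left hc0, ← EReal.coe_ennreal_toReal hPtop,
      ← EReal.coe_sub]
    congr 1
    ring
  rw [h2]
  exact EReal.sub_le_sub le_rfl (EReal.coe_ennreal_le_coe_ennreal_iff.2 hNL)

variable {n : ℕ} {w : ℂ × Cn n → ℝ} {p : ℝ}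

/-- Homogeneity thus turns multiplication of `z` by `exp (ζ / p)` into multiplication of the value
by `exp (Re ζ)`. -/
theorem norm_exp_div_rpow (hp : 0 < p) (ζ : ℂ) : ‖Complex.exp (ζ / p)‖ ^ p = Real.exp ζ.re := by
  rw [Complex.norm_exp, ← Real.exp_mul, Complex.div_ofReal_re, div_mul_cancel₀ _ hp.ne']

theorem mem_disc_of_disc_subset_cyl {a b : ℂ × Cn n}
    (hab : ∀ ζ : ℂ, ‖ζ‖ ≤ 1 → a + ζ • b ∈ cyl n) (ζ : ℂ) (hζ : ‖ζ‖ ≤ 1) :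
    a.1 + ζ * b.1 ∈ disc := by
  simpa using (hab ζ hζ).1

/-- The sub-mean value inequality for the truncated logarithm of a homogeneous plurisubharmonic
function. -/
theorem log_le_integral_log_max (hp : 0 < p) (hw : IsPSH (cyl n) (fun x => (w x : EReal)))
    (hhom : ∀ t ∈ disc, ∀ (l : ℂ) (z : Cn n), w (t, l • z) = ‖l‖ ^ p * w (t, z))
    {a b : ℂ × Cn n} (hab : ∀ ζ : ℂ, ‖ζ‖ ≤ 1 → a + ζ • b ∈ cyl n) (ha : 0 < w a)
    {e B : ℝ} (he : 0 < e) (hB : ∀ ζ : ℂ, ‖ζ‖ ≤ 1 → w (a + ζ • b) ≤ B) :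
    Real.log (w a) ≤ ∫ θ, Real.log (max (w (a + circleMap 0 1 θ • b)) e) ∂angMeas := by
  have husc := upperSemicontinuousOn_coe_ereal.1 hw.usc
  have hmono : Monotone fun x : ℝ => Real.log (max x e) := fun x y hxy =>
    Real.log_le_log (lt_max_of_lt_right he) (max_le_max_right _ hxy)
  have hcont : Continuous fun x : ℝ => Real.log (max x e) :=
    (continuous_id.max continuous_const).log fun x => (lt_max_of_lt_right he).ne'
  have hvusc : UpperSemicontinuousOn (fun ζ : ℂ => Real.log (max (w (a + ζ • b)) e))
      (Metric.sphere (0 : ℂ) 1) :=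
    hcont.comp_upperSemicontinuousOn (f := fun ζ : ℂ => w (a + ζ • b))
      (husc.comp (g := fun ζ : ℂ => a + ζ • b) (by fun_prop)
        fun ζ hζ => hab ζ (mem_sphere_zero_iff_norm.1 hζ).le) hmono
  have h := le_poisson_of_forall_polynomial
    (v := fun ζ => Real.log (max (w (a + ζ • b)) e)) (w := 0) (c := Real.log (w a))
    (M := max |Real.log e| |Real.log (max B e)|) (fun ζ hζ => ?_) hvusc (by simp) fun q hq => ?_
  · simpa only [pk_zero, one_mul] using h
  · refine abs_le_max_abs_abs (Real.log_le_log he (le_max_right _ _)) ?_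
    exact hmono (hB ζ (mem_sphere_zero_iff_norm.1 hζ).le)
  · have hmem := mem_disc_of_disc_subset_cyl hab
    -- After this twist the bound `log w ≤ Re q` reads `w ≤ 1`, so the maximum principle is applied
    -- with the constant polynomial `1`.
    have hval : ∀ ζ : ℂ, ‖ζ‖ ≤ 1 →
        w (a.1 + ζ * b.1, Complex.exp (-q.eval ζ / p) • (a.2 + ζ • b.2))
          = Real.exp (-(q.eval ζ).re) * w (a + ζ • b) := fun ζ hζ => by
      rw [hhom _ (hmem ζ hζ), norm_exp_div_rpow hp, Complex.neg_re]
      rfl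
    have h1 := hw.le_re_polynomial (a := a.1) (b := b.1)
      (f := fun ζ => Complex.exp (-q.eval ζ / p) • (a.2 + ζ • b.2)) hmem (by
        refine Differentiable.diffContOnCl ?_
        have := q.differentiable
        fun_prop) (Polynomial.C 1) (fun ζ hζ => ?_) (ζ₀ := 0) (by simp)
    · have h2 := hval 0 (by simp)
      rw [h2] at h1
      simp only [zero_smul, add_zero, Polynomial.eval_C, Complex.one_re] at h1
      rw [Real.exp_neg, inv_mul_le_iff₀ (Real.exp_pos _), mul_one] at h1
      rw [← Real.log_exp (q.eval 0).re]
      exact Real.log_le_log ha h1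
    · rw [mem_sphere_zero_iff_norm] at hζ
      rw [hval ζ hζ.le, Polynomial.eval_C, Complex.one_re, Real.exp_neg,
        inv_mul_le_iff₀ (Real.exp_pos _), mul_one]
      calc w (a + ζ • b) ≤ max (w (a + ζ • b)) e := le_max_left _ _
        _ = Real.exp (Real.log (max (w (a + ζ • b)) e)) :=
          (Real.exp_log (lt_max_of_lt_right he)).symm
        _ ≤ Real.exp (q.eval ζ).re := Real.exp_le_exp.2 (hq ζ (by simpa using hζ))

/-- The logarithm of a nonnegative homogeneous plurisubharmonic function is plurisubharmonic. -/
theorem IsPSH.log_of_homogeneous (hp : 0 < p) (hw : IsPSH (cyl n) (fun x => (w x : EReal)))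
    (hw0 : ∀ x ∈ cyl n, 0 ≤ w x)
    (hhom : ∀ t ∈ disc, ∀ (l : ℂ) (z : Cn n), w (t, l • z) = ‖l‖ ^ p * w (t, z)) :
    IsPSH (cyl n) (fun x => ENNReal.log (ENNReal.ofReal (w x))) where
  lt_top := fun x _ => ENNReal.log_lt_top_iff.2 ENNReal.ofReal_lt_top
  usc := (ENNReal.continuous_log.comp ENNReal.continuous_ofReal).comp_upperSemicontinuousOn
    (upperSemicontinuousOn_coe_ereal.1 hw.usc)
    (ENNReal.log_monotone.comp fun _ _ h => ENNReal.ofReal_le_ofReal h)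
  submean := fun a b hab => by
    rcases le_or_gt (w a) 0 with ha | ha
    · rw [ENNReal.log_ofReal, if_pos ha]
      exact bot_le
    have husc := upperSemicontinuousOn_coe_ereal.1 hw.usc
    have hm := (upperSemicontinuous_comp_circle husc hab).measurable
    obtain ⟨B, hB⟩ := bddAbove_disc husc hab
    rw [ENNReal.log_ofReal_of_pos ha]
    have hgm : ∀ k : ℕ, Measurable fun θ =>
        Real.log (max (w (a + circleMap 0 1 θ • b)) (Real.exp (-(k : ℝ)))) := fun k =>
      Real.measurable_log.comp (hm.max measurable_const)
    -- Truncating `w` at `exp (-k)` truncates `log w` at `-k ≤ 0`, which leaves the positive part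
    -- unchanged.
    have hpos : ∀ (k : ℕ) {x : ℝ}, 0 < x →
        Real.log (max x (Real.exp (-(k : ℝ)))) = max (Real.log x) (-k) := by
      intro k x hx
      rcases le_total x (Real.exp (-(k : ℝ))) with h | h
      · rw [max_eq_right h, Real.log_exp, max_eq_right]
        rwa [Real.log_le_iff_le_exp hx]
      · rw [max_eq_left h, max_eq_left]
        rwa [Real.le_log_iff_exp_le hx]
    refine le_angularMean_of_truncations
      (g := fun k θ => Real.log (max (w (a + circleMap 0 1 θ • b)) (Real.exp (-(k : ℝ)))))
      hgm (fun k => ?_) (fun k θ => ?_) (fun θ => ?_) ?_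
      (fun k => log_le_integral_log_max hp hw hhom hab ha (Real.exp_pos _) hB)
    · refine integrable_angMeas_of_bound (hgm k)
        (C := max |Real.log (Real.exp (-(k : ℝ)))| |Real.log (max B (Real.exp (-(k : ℝ))))|)
        fun θ => ?_
      refine abs_le_max_abs_abs (Real.log_le_log (Real.exp_pos _) (le_max_right _ _)) ?_
      exact Real.log_le_log (lt_max_of_lt_right (Real.exp_pos _))
        (max_le_max_right _ (hB _ (by simp)))
    · rcases (hw0 _ (hab (circleMap 0 1 θ) (by simp))).eq_or_lt with h0 | h0
      · rw [← h0, max_eq_right (Real.exp_pos _).le, Real.log_exp]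
        simp
      · rw [ENNReal.log_ofReal_of_pos h0, hpos k h0, EReal.real_coe_toENNReal,
          ENNReal.ofReal_max, ENNReal.ofReal_of_nonpos (p := -(k : ℝ)) (by simp)]
        simp
    · rcases (hw0 _ (hab (circleMap 0 1 θ) (by simp))).eq_or_lt with h0 | h0
      · have h1 : ∀ k : ℕ, ENNReal.ofReal (-Real.log (max (0 : ℝ) (Real.exp (-(k : ℝ)))))
            = (k : ENNReal) := fun k => by
          rw [max_eq_right (Real.exp_pos _).le, Real.log_exp, neg_neg, ENNReal.ofReal_natCast]
        simp only [← h0, h1, ENNReal.iSup_natCast]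
        exact le_top
      · obtain ⟨k, hk⟩ := exists_nat_ge (-Real.log (w (a + circleMap 0 1 θ • b)))
        refine le_trans ?_ (le_iSup _ k)
        rw [ENNReal.log_ofReal_of_pos h0, hpos k h0, max_eq_left (by linarith), ← EReal.coe_neg,
          EReal.real_coe_toENNReal]
    · intro k l hkl θ
      refine Real.log_le_log (lt_max_of_lt_right (Real.exp_pos _)) (max_le_max_left _ ?_)
      exact Real.exp_le_exp.2 (neg_le_neg (by exact_mod_cast hkl))

/-! ### Harmonic along a holomorphic curve implies constant -/

/-- The sub-mean value inequality for a homogeneous plurisubharmonic function, harmonic along a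
holomorphic curve, after multiplying the curve by an exponential. -/
theorem re_le_integral_exp_mul (hp : 0 < p) (hw : IsPSH (cyl n) (fun x => (w x : EReal)))
    (hhom : ∀ t ∈ disc, ∀ (l : ℂ) (z : Cn n), w (t, l • z) = ‖l‖ ^ p * w (t, z))
    {h : ℂ → Cn n} (hh : DifferentiableOn ℂ h disc) {F : ℂ → ℂ} (hF : DifferentiableOn ℂ F disc)
    (hFw : ∀ t ∈ disc, w (t, h t) = (F t).re) {r : ℝ} (hr0 : 0 < r) (hr1 : r < 1) (δ : ℝ) :
    (F 0).re ≤ ∫ θ, Real.exp (-δ * (F (r * circleMap 0 1 θ) - F 0).re)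
      * (F (r * circleMap 0 1 θ)).re ∂angMeas := by
  have hmem : ∀ ζ : ℂ, ‖ζ‖ ≤ 1 → (r : ℂ) * ζ ∈ disc := fun ζ hζ => by
    rw [mem_ball_zero_iff, norm_mul, Complex.norm_real, Real.norm_of_nonneg hr0.le]
    nlinarith [norm_nonneg ζ]
  have hmaps : MapsTo (fun ζ : ℂ => (r : ℂ) * ζ) (Metric.closedBall 0 1) disc := fun ζ hζ =>
    hmem ζ (mem_closedBall_zero_iff.1 hζ)
  have hFr : DifferentiableOn ℂ (fun ζ : ℂ => F (r * ζ)) (Metric.closedBall 0 1) :=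
    hF.comp (g := F) (f := fun ζ : ℂ => (r : ℂ) * ζ) (by fun_prop) hmaps
  have hhr : DifferentiableOn ℂ (fun ζ : ℂ => h (r * ζ)) (Metric.closedBall 0 1) :=
    hh.comp (g := h) (f := fun ζ : ℂ => (r : ℂ) * ζ) (by fun_prop) hmaps
  let f : ℂ → Cn n := fun ζ => Complex.exp ((-δ * (F (r * ζ) - F 0)) / p) • h (r * ζ)
  have hf : DiffContOnCl ℂ f (Metric.ball 0 1) := by
    refine DifferentiableOn.diffContOnCl ?_
    rw [closure_ball _ one_ne_zero]
    exact DifferentiableOn.fun_smul (by fun_prop) hhr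
  have hval : ∀ ζ : ℂ, ‖ζ‖ ≤ 1 → w (r * ζ, f ζ)
      = Real.exp (-δ * (F (r * ζ) - F 0).re) * (F (r * ζ)).re := fun ζ hζ => by
    dsimp only [f]
    rw [hhom _ (hmem ζ hζ), norm_exp_div_rpow hp, hFw _ (hmem ζ hζ)]
    congr 2
    rw [← Complex.ofReal_neg, Complex.re_ofReal_mul]
  have hcont : ContinuousOn (fun ζ : ℂ => Real.exp (-δ * (F (r * ζ) - F 0).re) * (F (r * ζ)).re)
      (Metric.closedBall 0 1) := by
    have h1 := Complex.continuous_re.comp_continuousOn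
      (hFr.continuousOn.sub (continuousOn_const (c := F 0)))
    exact (Real.continuous_exp.comp_continuousOn (continuousOn_const.mul h1)).mul
      (Complex.continuous_re.comp_continuousOn hFr.continuousOn)
  have hsub : Metric.sphere (0 : ℂ) 1 ⊆ Metric.closedBall 0 1 := Metric.sphere_subset_closedBall
  obtain ⟨M, hM⟩ := (isCompact_closedBall (0 : ℂ) 1).exists_bound_of_continuousOn hcont
  have hmain := le_poisson_of_forall_polynomial (w := 0) (c := (F 0).re)
    (fun ζ hζ => hM ζ (hsub hζ)) (hcont.mono hsub).upperSemicontinuousOn (by simp) fun q hq => ?_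
  · simpa only [pk_zero, one_mul] using hmain
  · have h1 := hw.le_re_polynomial (a := 0) (b := r) (f := f)
      (fun ζ hζ => by rw [zero_add, mul_comm]; exact hmem ζ hζ) hf q
      (fun ζ hζ => by
        rw [zero_add, mul_comm, hval ζ (mem_sphere_zero_iff_norm.1 hζ).le]
        exact hq ζ hζ) (ζ₀ := 0) (by simp)
    have h2 := hval 0 (by simp)
    rw [mul_zero] at h2
    rw [zero_mul, add_zero, h2] at h1
    simpa using h1

/-- `Q` has mean zero, so in the twisted sub-mean inequality the first-order term in `δ` is `-δ`
times the mean of `Q ^ 2`. Letting `δ → 0` forces that mean to vanish. -/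
theorem eq_on_circle_of_homogeneous (hp : 0 < p) (hw : IsPSH (cyl n) (fun x => (w x : EReal)))
    (hw0 : ∀ x ∈ cyl n, 0 ≤ w x)
    (hhom : ∀ t ∈ disc, ∀ (l : ℂ) (z : Cn n), w (t, l • z) = ‖l‖ ^ p * w (t, z))
    {h : ℂ → Cn n} (hh : DifferentiableOn ℂ h disc) {F : ℂ → ℂ} (hF : DifferentiableOn ℂ F disc)
    (hFw : ∀ t ∈ disc, w (t, h t) = (F t).re) {r : ℝ} (hr0 : 0 < r) (hr1 : r < 1) {ζ : ℂ}
    (hζ : ‖ζ‖ = 1) : (F (r * ζ)).re = (F 0).re := by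
  have hmem : ∀ ζ : ℂ, ‖ζ‖ ≤ 1 → (r : ℂ) * ζ ∈ disc := fun ζ hζ => by
    rw [mem_ball_zero_iff, norm_mul, Complex.norm_real, Real.norm_of_nonneg hr0.le]
    nlinarith [norm_nonneg ζ]
  have hFr : DifferentiableOn ℂ (fun ζ : ℂ => F (r * ζ)) (Metric.closedBall 0 1) :=
    hF.comp (g := F) (f := fun ζ : ℂ => (r : ℂ) * ζ) (by fun_prop) fun ζ hζ =>
      hmem ζ (mem_closedBall_zero_iff.1 hζ)
  let Q : ℝ → ℝ := fun θ => (F (r * circleMap 0 1 θ) - F 0).re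
  have hcirc : ∀ θ : ℝ, circleMap 0 1 θ ∈ Metric.closedBall (0 : ℂ) 1 := fun θ =>
    Metric.sphere_subset_closedBall (circleMap_mem_unit θ)
  have hQc : Continuous Q :=
    Complex.continuous_re.comp ((hFr.continuousOn.comp_continuous
      (continuous_circleMap 0 1) hcirc).sub continuous_const)
  have hFQ : ∀ θ, (F (r * circleMap 0 1 θ)).re = (F 0).re + Q θ := fun θ => by simp [Q]
  have hpos : ∀ θ, 0 ≤ (F 0).re + Q θ := fun θ => by
    have h1 := hmem (circleMap 0 1 θ) (by simp)
    rw [← hFQ, ← hFw _ h1]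
    exact hw0 _ ⟨h1, mem_univ _⟩
  have hu0 : 0 ≤ (F 0).re := by
    have h1 : (0 : ℂ) ∈ disc := by simp
    rw [← hFw _ h1]
    exact hw0 _ ⟨h1, mem_univ _⟩
  have hQmean : ∫ θ, Q θ ∂angMeas = 0 := by
    have h1 : DiffContOnCl ℂ (fun ζ : ℂ => F (r * ζ) - F 0) (Metric.ball 0 1) := by
      refine DifferentiableOn.diffContOnCl ?_
      rw [closure_ball _ one_ne_zero]
      exact hFr.sub_const (F 0)
    have := integral_re_circle h1
    simpa [Q] using this
  obtain ⟨B, hB⟩ : ∃ B, ∀ θ, |Q θ| ≤ B := by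
    have h1 : ContinuousOn (fun ζ : ℂ => (F (r * ζ) - F 0).re) (Metric.closedBall 0 1) :=
      Complex.continuous_re.comp_continuousOn (hFr.continuousOn.sub continuousOn_const)
    obtain ⟨B, hB⟩ := (isCompact_closedBall (0 : ℂ) 1).exists_bound_of_continuousOn h1
    exact ⟨B, fun θ => hB _ (hcirc θ)⟩
  have hB0 : 0 ≤ B := (abs_nonneg _).trans (hB 0)
  set u₀ := (F 0).re
  set D := B ^ 2 * (u₀ + B)
  have hD : 0 ≤ D := by positivity
  have key : ∀ δ : ℝ, 0 < δ → δ * B ≤ 1 → ∫ θ, Q θ ^ 2 ∂angMeas ≤ δ * D := by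
    intro δ hδ hδB
    have h1 := re_le_integral_exp_mul hp hw hhom hh hF hFw hr0 hr1 δ
    -- From `exp x ≤ 1 + x + x ^ 2` for `|x| ≤ 1`, multiplied by `u₀ + Q θ ≥ 0`; `D` bounds the
    -- factor of `δ ^ 2`.
    have h2 : ∀ θ, Real.exp (-δ * Q θ) * (u₀ + Q θ)
        ≤ (u₀ + δ ^ 2 * D) + ((1 - δ * u₀) * Q θ - δ * Q θ ^ 2) := fun θ => by
      have hx : |-δ * Q θ| ≤ 1 := by
        rw [abs_mul, abs_neg, abs_of_pos hδ]
        exact (mul_le_mul_of_nonneg_left (hB θ) hδ.le).trans hδB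
      have h3 := (abs_le.1 (Real.abs_exp_sub_one_sub_id_le hx)).2
      have h4 : Real.exp (-δ * Q θ) ≤ 1 - δ * Q θ + δ ^ 2 * B ^ 2 := by
        have h5 : Q θ ^ 2 ≤ B ^ 2 := by
          rw [← sq_abs]; exact pow_le_pow_left₀ (abs_nonneg _) (hB θ) 2
        nlinarith [mul_le_mul_of_nonneg_left h5 (sq_nonneg δ)]
      have h6 := mul_le_mul_of_nonneg_right h4 (hpos θ)
      have h7 : δ ^ 2 * B ^ 2 * (u₀ + Q θ) ≤ δ ^ 2 * D := by
        have : u₀ + Q θ ≤ u₀ + B := by linarith [(abs_le.1 (hB θ)).2]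
        calc δ ^ 2 * B ^ 2 * (u₀ + Q θ) ≤ δ ^ 2 * B ^ 2 * (u₀ + B) := by gcongr
          _ = δ ^ 2 * D := by ring
      nlinarith
    have h3 : u₀ ≤ ∫ θ, ((u₀ + δ ^ 2 * D) + ((1 - δ * u₀) * Q θ - δ * Q θ ^ 2)) ∂angMeas := by
      refine h1.trans ?_
      simp only [hFQ]
      refine integral_mono (integrable_angMeas_of_continuous ?_)
        (integrable_angMeas_of_continuous (by fun_prop)) h2
      change Continuous fun θ => Real.exp (-δ * Q θ) * (u₀ + Q θ)
      fun_prop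
    rw [integral_add (integrable_const _) (integrable_angMeas_of_continuous (by fun_prop)),
      integral_sub (integrable_angMeas_of_continuous (by fun_prop))
        (integrable_angMeas_of_continuous (by fun_prop)),
      integral_const_mul, integral_const_mul, hQmean] at h3
    simp at h3
    have h4 : δ * ∫ θ, Q θ ^ 2 ∂angMeas ≤ δ * (δ * D) := by nlinarith
    exact le_of_mul_le_mul_left h4 hδ
  have hle : ∫ θ, Q θ ^ 2 ∂angMeas ≤ 0 := by
    refine le_of_forall_pos_le_add fun ε hε => ?_
    have h1 := key (min (1 / (B + 1)) (ε / (D + 1))) (by positivity) ?_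
    · refine h1.trans ?_
      calc min (1 / (B + 1)) (ε / (D + 1)) * D ≤ ε / (D + 1) * (D + 1) :=
            mul_le_mul (min_le_right _ _) (by linarith) hD (by positivity)
        _ = 0 + ε := by field_simp; ring
    · calc min (1 / (B + 1)) (ε / (D + 1)) * B ≤ 1 / (B + 1) * (B + 1) :=
            mul_le_mul (min_le_left _ _) (by linarith) hB0 (by positivity)
        _ = 1 := by field_simp
  obtain ⟨θ₀, hθ₀, rfl⟩ : ζ ∈ circleMap 0 1 '' Ioc 0 (2 * Real.pi) := by
    rw [image_circleMap_Ioc]; simpa using hζ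
  -- `Q ^ 2` is continuous, so one nonzero value would make its integral positive.
  by_contra hne
  have hQ0 : 0 < Q θ₀ ^ 2 := by
    have : Q θ₀ ≠ 0 := fun h0 => hne (by rw [hFQ, h0, add_zero])
    positivity
  have hpos2 := intervalIntegral.integral_pos Real.two_pi_pos
    (f := fun θ => Q θ ^ 2) (by fun_prop) (fun θ _ => sq_nonneg _)
    ⟨θ₀, Ioc_subset_Icc_self hθ₀, hQ0⟩
  rw [integral_angMeas] at hle
  have : 0 < (2 * Real.pi)⁻¹ * ∫ θ in (0 : ℝ)..(2 * Real.pi), Q θ ^ 2 := by positivity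
  linarith

/-! ### Homogeneity of the envelope -/

theorem IsBoundaryData.of_uniformGrowth {φ : bdry → Cn n → ℝ} (hp : 0 < p)
    (hnonneg : ∀ s z, 0 ≤ φ s z) (hmeas : Measurable (Function.uncurry φ))
    (hconv : ∀ s, ConvexOn ℝ Set.univ (φ s)) (hgrowth : UniformGrowth p φ) :
    IsBoundaryData φ where
  nonneg := hnonneg
  meas := hmeas
  conv := hconv
  bound := fun R => by
    obtain ⟨c, C, A, -, hC, -, h⟩ := hgrowth
    refine ⟨C * R ^ p + A, fun s z hz => (h s z).2.trans ?_⟩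
    gcongr

/-- The envelope composed with `z ↦ l • z` and divided by `‖l‖ ^ p` is again a competitor, because
the Poisson integral scales by the same factor. -/
theorem smul_le_interp {φ : bdry → Cn n → ℝ} (hφ : IsBoundaryData φ)
    (hhom : ∀ (s : bdry) (l : ℂ) (z : Cn n), φ s (l • z) = ‖l‖ ^ p * φ s z) {l : ℂ} (hl : l ≠ 0)
    {t : ℂ} (ht : ‖t‖ < 1) (z : Cn n) : interp φ t (l • z) ≤ ‖l‖ ^ p * interp φ t z := by
  set c := ‖l‖ ^ p
  have hc : 0 < c := Real.rpow_pos_of_pos (norm_pos_iff.2 hl) p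
  have hmem : ∀ x : ℂ × Cn n, x ∈ cyl n → (x.1, l • x.2) ∈ cyl n := fun x hx => ⟨hx.1, mem_univ _⟩
  have hpoisson : ∀ τ y, poissonInt φ (τ, l • y) = c * poissonInt φ (τ, y) := fun τ y => by
    rw [poissonInt, poissonInt, ← integral_const_mul]
    refine integral_congr_ae (Eventually.of_forall fun θ => ?_)
    simp only [hhom]
    ring
  have hψ : IsCompetitor φ fun x => c⁻¹ * interpStar φ (x.1, l • x.2) := by
    refine hφ.isCompetitor_of_le_poissonInt (isPSH_coe ?_ (fun x hx => ?_) fun a b hab => ?_)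
      fun τ y hτ => ?_
    · refine (continuous_const_mul c⁻¹).comp_upperSemicontinuousOn
        (f := fun x : ℂ × Cn n => interpStar φ (x.1, l • x.2))
        (hφ.upperSemicontinuousOn_interpStar.comp (g := fun x : ℂ × Cn n => (x.1, l • x.2))
          (by fun_prop) hmem) fun x y hxy => ?_
      exact mul_le_mul_of_nonneg_left hxy (by positivity)
    · exact mul_nonneg (by positivity) (hφ.interpStar_nonneg (hmem x hx))
    · have hlin : ∀ ζ : ℂ, ((a.1, l • a.2) + ζ • (b.1, l • b.2) : ℂ × Cn n)
          = ((a + ζ • b).1, l • (a + ζ • b).2) := fun ζ => by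
        simp [smul_comm ζ l]
      have h1 := hφ.interpStar_submean (a := (a.1, l • a.2)) (b := (b.1, l • b.2))
        fun ζ hζ => by rw [hlin]; exact hmem _ (hab ζ hζ)
      rw [integral_const_mul]
      simp only [hlin] at h1
      exact mul_le_mul_of_nonneg_left h1 (by positivity)
    · rw [inv_mul_le_iff₀ hc, ← hpoisson]
      exact hφ.interpStar_le_poissonInt (mem_cyl.2 hτ)
  have h1 := hφ.le_interp hψ ht z
  rw [inv_mul_le_iff₀ hc] at h1
  rwa [hφ.interpStar_eq (mem_cyl.2 ht)] at h1

theorem interp_smul {φ : bdry → Cn n → ℝ} (hp : 0 < p) (hφ : IsBoundaryData φ)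
    (hhom : ∀ (s : bdry) (l : ℂ) (z : Cn n), φ s (l • z) = ‖l‖ ^ p * φ s z) (l : ℂ)
    {t : ℂ} (ht : ‖t‖ < 1) (z : Cn n) : interp φ t (l • z) = ‖l‖ ^ p * interp φ t z := by
  rcases eq_or_ne l 0 with rfl | hl
  · have h0 : ∀ s, φ s (0 : Cn n) ≤ 0 := fun s => by
      have := hhom s 0 0
      rw [norm_zero, Real.zero_rpow hp.ne', zero_mul, smul_zero] at this
      exact this.le
    rw [norm_zero, Real.zero_rpow hp.ne', zero_mul, zero_smul]
    exact le_antisymm ((hφ.interp_le_poissonInt ht 0).trans (hφ.poissonInt_le ht h0))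
      (hφ.interp_nonneg ht 0)
  · refine le_antisymm (smul_le_interp hφ hhom hl ht z) ?_
    -- The reverse inequality is the same one for `l⁻¹` at the point `l • z`.
    have h1 := smul_le_interp hφ hhom (inv_ne_zero hl) ht (l • z)
    rw [smul_smul, inv_mul_cancel₀ hl, one_smul, norm_inv, Real.inv_rpow (norm_nonneg l)] at h1
    rwa [← le_inv_mul_iff₀ (Real.rpow_pos_of_pos (norm_pos_iff.2 hl) p)]

end

end

end PshInterp

/-! ### The theorem -/

theorem mainTheorem7 (n : ℕ) (p : ℝ) (hp : 1 < p)
    (φ : PshInterp.bdry → PshInterp.Cn n → ℝ)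
    (hnonneg : ∀ s z, 0 ≤ φ s z)
    (hmeas : Measurable (Function.uncurry φ))
    (hconv : ∀ s, ConvexOn ℝ Set.univ (φ s))
    (hgrowth : PshInterp.UniformGrowth p φ)
    (hhom : ∀ (s : PshInterp.bdry) (l : ℂ) (z : PshInterp.Cn n), φ s (l • z) = ‖l‖ ^ p * φ s z) :
    -- `[φ]` is a genuine supremum, finite and nonnegative
    (∀ t ∈ PshInterp.disc, ∀ z : PshInterp.Cn n,
      IsLUB (PshInterp.competitorValues φ t z) (PshInterp.interp φ t z) ∧
        0 ≤ PshInterp.interp φ t z) ∧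
    -- (i)
    (∀ t ∈ PshInterp.disc, ∀ (l : ℂ) (z : PshInterp.Cn n),
      PshInterp.interp φ t (l • z) = ‖l‖ ^ p * PshInterp.interp φ t z) ∧
    -- (ii), with `log 0 = -∞`
    PshInterp.IsPSH (PshInterp.disc ×ˢ (Set.univ : Set (PshInterp.Cn n)))
      (fun x => ENNReal.log (ENNReal.ofReal (PshInterp.interp φ x.1 x.2))) ∧
    -- (iii)
    (∀ h : ℂ → PshInterp.Cn n, DifferentiableOn ℂ h PshInterp.disc →
      InnerProductSpace.HarmonicOnNhd (fun t => PshInterp.interp φ t (h t)) PshInterp.disc →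
      ∃ k : ℝ, ∀ t ∈ PshInterp.disc, PshInterp.interp φ t (h t) = k) := by
  have hp0 : 0 < p := one_pos.trans hp
  have hφ := PshInterp.IsBoundaryData.of_uniformGrowth hp0 hnonneg hmeas hconv hgrowth
  have hhomI : ∀ t ∈ PshInterp.disc, ∀ (l : ℂ) (z : PshInterp.Cn n),
      PshInterp.interp φ t (l • z) = ‖l‖ ^ p * PshInterp.interp φ t z := fun t ht l z =>
    PshInterp.interp_smul hp0 hφ hhom l (mem_ball_zero_iff.1 ht) z
  have heq : ∀ t ∈ PshInterp.disc, ∀ z : PshInterp.Cn n,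
      PshInterp.interpStar φ (t, z) = PshInterp.interp φ t z := fun t ht z =>
    hφ.interpStar_eq ⟨ht, Set.mem_univ z⟩
  have hhomS : ∀ t ∈ PshInterp.disc, ∀ (l : ℂ) (z : PshInterp.Cn n),
      PshInterp.interpStar φ (t, l • z) = ‖l‖ ^ p * PshInterp.interpStar φ (t, z) :=
    fun t ht l z => by rw [heq t ht, heq t ht, hhomI t ht]
  refine ⟨fun t ht z => ?_, hhomI, ?_, fun h hh hharm => ?_⟩
  · rw [mem_ball_zero_iff] at ht
    exact ⟨hφ.isLUB_interp ht z, hφ.interp_nonneg ht z⟩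
  · refine (hφ.isPSH_interpStar.log_of_homogeneous hp0 (fun _ hx => hφ.interpStar_nonneg hx)
      hhomS).congr fun x hx => ?_
    dsimp only
    rw [hφ.interpStar_eq hx]
  · obtain ⟨F, hF, hFu⟩ := hharm.exists_analyticOnNhd_ball_re_eq
    refine ⟨(F 0).re, fun t ht => ?_⟩
    refine (hFu ht).symm.trans ?_
    rcases eq_or_ne t 0 with rfl | ht0
    · rfl
    have hpos : 0 < ‖t‖ := norm_pos_iff.2 ht0
    -- Here the circle about `0` is the one through `t`, of radius `‖t‖`.
    have h1 := PshInterp.eq_on_circle_of_homogeneous hp0 hφ.isPSH_interpStar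
      (fun _ hx => hφ.interpStar_nonneg hx) hhomS hh hF.differentiableOn
      (fun τ hτ => by rw [heq τ hτ]; exact (hFu hτ).symm) hpos (mem_ball_zero_iff.1 ht)
      (ζ := t / ‖t‖) (by simp [hpos.ne'])
    rwa [mul_div_cancel₀ _ (by exact_mod_cast hpos.ne')] at h1
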